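/- Let $G$ be a non-compact simple real Lie group with finite center that is split: its Lie algebra $\mathfrak g$ is simple and has a Cartan subalgebra $\mathfrak a$ such that $\operatorname{ad}(H)$ is diagonalizable over $\mathbb R$ for every $H\in\mathfrak a$. Let $A=\exp\mathfrak a$ be the corresponding maximal torus, and let $\alpha\in\mathfrak a^\ast$ be a root of $(G,A)$. For $\beta=\pm\alpha$ let $G^{\beta}=\exp\mathfrak g_\beta$ be the root subgroup, where $\mathfrak g_\beta=\{X\in\mathfrak g: [H,X]=\beta(H)X\ \ \forall H\in\mathfrak a\}$, and let $\ker(\alpha)=\exp\{H\in\mathfrak a:\alpha(H)=0\}\le A$. Write $C_G(A)$ for the centralizer of $A$ in $G$, and for $s\in A$ let $N_s=\{g\in G:\lim_{n\to-\infty}s^ngs^{-n}=e\}$. Let $G$ act on a closed manifold $M$ by a $C^1$ action that is locally free (all stabilizers are discrete). For a closed subgroup $H\le G$ and a Borel probability measure $\mu$ on $M$, a measurable partition $\eta$ of $M$ (one given by a countably generated $\sigma$-algebra of Borel sets) is subordinate to the $H$-orbits if for $\mu$-a.e. $x$ its element $\eta(x)\ni x$ is contained in $H\cdot x$ and contains $U\cdot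 x$ for some neighborhood $U$ of $e$ in $H$. A family $\{\mu_x^H\}_{x\in M}$ of measures on $H$ is a family of leafwise measures of $\mu$ along the $H$-orbits if for every such $\eta$ there is a measurable function $c^\eta:M\to(0,\infty)$ such that the conditional measures $\mu_x^\eta$ of $\mu$ satisfy $$\mu_x^\eta=c^\eta(x)\,\bigl((h\mapsto h\cdot x)_\ast\mu_x^H\bigr)\big|_{\eta(x)}\qquad\text{for }\mu\text{-a.e. }x .$$ **Proposition (Entropic measure rigidity).** Let $s\in\ker(\alpha)\setminus\{e\}$, and let $\mu$ be a Borel probability measure on $M$ that is invariant and ergodic under $x\mapsto s\cdot x$ and invariant under $C_G(A)\ltimes\langle N_s,G^{\alpha}\rangle$. Let $\{\mu_x^{G^{-\alpha}}\}_{x\in M}$ be a family of leafwise measures of $\mu$ along the $G^{-\alpha}$-orbits. If $\mu_x^{G^{-\alpha}}$ is non-atomic (has no atoms) for $\mu$-a.e. $x$, then $\mu$ is $G^{-\alpha}$-invariant. -/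

import Mathlib

open MeasureTheory ProbabilityTheory Filter Topology
open scoped Manifold ContDiff NNReal

namespace EntropicRigidity

section LieGroups

variable {n : ℕ} {G : Type*} [TopologicalSpace G] [ChartedSpace (EuclideanSpace ℝ (Fin n)) G]
  [Group G]

/-- A smooth Lie group has the regularity that the Lie bracket on its tangent space needs. -/
instance instLEInftyMinSmoothness : ENat.LEInfty (minSmoothness ℝ 3) where
  out := by
    rw [minSmoothness_of_isRCLikeNormedField]
    exact ENat.LEInfty.out

/-- `g = exp X`: the integral curve of the left-invariant vector field of `X` that starts at the
identity is at `g` at time `1`. -/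
def IsExp (X : GroupLieAlgebra (𝓡 n) G) (g : G) : Prop :=
  ∃ γ : ℝ → G, γ 0 = 1 ∧ IsMIntegralCurve (I := 𝓡 n) γ (mulInvariantVectorField X) ∧ γ 1 = g

/-- The subgroup of `G` generated by `exp V`, for a linear subspace `V` of the Lie algebra of `G`.
If `V` is a Lie subalgebra, this is the connected Lie subgroup with Lie algebra `V`. -/
def expSubgroup (V : Submodule ℝ (GroupLieAlgebra (𝓡 n) G)) : Subgroup G :=
  Subgroup.closure {g | ∃ X ∈ V, IsExp X g}

variable [LieGroup (𝓡 n) ∞ G]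

/-- The connected subgroup `A = exp 𝔞` of `G`. -/
noncomputable def torus (𝔞 : LieSubalgebra ℝ (GroupLieAlgebra (𝓡 n) G)) : Subgroup G :=
  expSubgroup 𝔞.toSubmodule

/-- The linear functional `α` on `𝔞` is a root: it is nonzero, with nonzero root space. -/
def IsRoot (𝔞 : LieSubalgebra ℝ (GroupLieAlgebra (𝓡 n) G)) [LieRing.IsNilpotent 𝔞]
    (α : Module.Dual ℝ 𝔞) : Prop :=
  α ≠ 0 ∧ LieAlgebra.rootSpace 𝔞 (⇑α) ≠ ⊥

/-- The root subgroup `G^α`, the connected subgroup of `G` tangent to the root space of `α`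
(in the split case root spaces of nonzero `α` are at most one-dimensional). -/
noncomputable def rootSubgroup (𝔞 : LieSubalgebra ℝ (GroupLieAlgebra (𝓡 n) G)) [LieRing.IsNilpotent 𝔞]
    (α : Module.Dual ℝ 𝔞) : Subgroup G :=
  expSubgroup (LieAlgebra.rootSpace 𝔞 (⇑α)).toSubmodule

/-- The hyperplane `ker α` of `A = exp 𝔞`, that is `exp {H ∈ 𝔞 | α H = 0}`. -/
noncomputable def rootKernel (𝔞 : LieSubalgebra ℝ (GroupLieAlgebra (𝓡 n) G)) (α : Module.Dual ℝ 𝔞) :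
    Subgroup G :=
  expSubgroup ((LinearMap.ker α).map 𝔞.toSubmodule.subtype)

end LieGroups

/-- The subgroup `N_s` of all `g` with `s ^ n * g * s ^ (-n) → 1` as `n → -∞`. -/
def unstableSubgroup {G : Type*} [Group G] [TopologicalSpace G] [IsTopologicalGroup G] (s : G) :
    Subgroup G where
  carrier := {g | Tendsto (fun n : ℤ => s ^ n * g * s ^ (-n)) atBot (𝓝 1)}
  one_mem' := by
    have h : (fun n : ℤ => s ^ n * 1 * s ^ (-n)) = fun _ => 1 := by
      funext n
      group
    simp only [Set.mem_ofPred_eq, h]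
    exact tendsto_const_nhds
  mul_mem' := by
    intro a b ha hb
    have h := Tendsto.mul ha hb
    simp only [mul_one] at h
    refine h.congr fun n => ?_
    group
  inv_mem' := by
    intro a ha
    have h := Tendsto.inv ha
    simp only [inv_one] at h
    refine h.congr fun n => ?_
    group

/-- The Borel σ-algebra of a compact, second countable Hausdorff space is standard. -/
instance standardBorelSpace_of_compact (M : Type*) [TopologicalSpace M] [CompactSpace M] [T2Space M]
    [SecondCountableTopology M] [MeasurableSpace M] [BorelSpace M] : StandardBorelSpace M := by
  let _ := TopologicalSpace.metrizableSpaceMetric M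
  infer_instance

section Leafwise

/-- A measurable partition of `M`, given by the countably generated sub-σ-algebra `sigma` of the
measurable sets that are unions of elements of the partition. -/
structure MeasurablePartition (M : Type*) [mM : MeasurableSpace M] where
  sigma : MeasurableSpace M
  sigma_le : sigma ≤ mM
  countablyGenerated : @MeasurableSpace.CountablyGenerated M sigma

/-- The element `η(x)` of the partition `η` that contains `x`. -/
def MeasurablePartition.cell {M : Type*} [MeasurableSpace M] (η : MeasurablePartition M) (x : M) :
    Set M :=
  @measurableAtom M η.sigma x

variable {G : Type*} [Group G] [TopologicalSpace G] {M : Type*} [MeasurableSpace M] [MulAction G M]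

/-- The measurable partition `η` is subordinate to the `H`-orbits: for almost every `x`, the element
`η(x)` lies in the orbit `H • x` and contains a neighborhood of `x` in that orbit (for the topology
of the orbit that comes from `H`). -/
def IsSubordinate (H : Subgroup G) (μ : Measure M) (η : MeasurablePartition M) : Prop :=
  ∀ᵐ x ∂μ, η.cell x ⊆ MulAction.orbit H x ∧ {h : H | h • x ∈ η.cell x} ∈ 𝓝 (1 : H)

/-- `ν` is a family of leafwise measures of `μ` along the `H`-orbits: for every measurable partition
`η` subordinate to the `H`-orbits, the conditional measure of `μ` on `η(x)` is, for almost every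
`x`, a positive multiple `c x` of the image of `ν x` under `h ↦ h • x`, restricted to `η(x)`. -/
def IsLeafwiseFamily [MeasurableSpace G] [StandardBorelSpace M] (H : Subgroup G) (μ : Measure M)
    [IsFiniteMeasure μ] (ν : M → Measure H) : Prop :=
  ∀ η : MeasurablePartition M, IsSubordinate H μ η →
    ∃ c : M → ℝ≥0, Measurable c ∧ (∀ x, 0 < c x) ∧
      ∀ᵐ x ∂μ, condExpKernel μ η.sigma x =
        c x • ((ν x).map (fun h : H => h • x)).restrict (η.cell x)

end Leafwise

end EntropicRigidity

/-! The element `s` lies in `ker α`, so it commutes with the root group `G^{-α}`, and `μ` is ergodic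
under `s`. Call a point generic if its Birkhoff averages under `s`, along one fixed sequence of
times, converge to the `μ`-integral for every continuous function; almost every point is generic. If
`x` and `g • x` are both generic and `g` commutes with `s`, the averages of `f` at `g • x` are those
of `f ∘ g` at `x`, so `g` preserves `μ` (`map_eq_of_mem_genericPoints`).

Root spaces are lines, so `G^{-α}` is trivial or a one-parameter group `γ`. The times `t` at which
`γ t` preserves `μ` form a closed subgroup of `ℝ`. Either it is all of `ℝ`, as claimed, or it is
cyclic, and then a generic point returns to the generic set only at countably many times
(`forall_map_eq_or_exists_countable`). The second case contradicts the absence of atoms: on a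
subordinate partition, the conditional probability at a typical point is carried by generic points,
yet it is a multiple of the restricted image of a leafwise measure, which gives countable sets mass
zero (`not_exists_null_of_isLeafwiseFamily`).

Two further facts are needed. A subordinate partition must exist; it is built from local sections of
the flow (`exists_local_section`, `exists_partition_subordinate_flow`). And `exp` and the bracket
must be tied to the group: the derivative of `Ad` is the bracket (`fderiv_adjoint`), which shows
that `s` commutes with `γ` and that `t` is controlled by `Ad (γ t)`. -/

namespace EntropicRigidity

/-! ### Mean ergodic theorem and almost everywhere convergent subsequences -/

section Ergodic

open scoped ENNReal

variable {M : Type*} [MeasurableSpace M] {μ : Measure M} {T : M → M}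

theorem integral_birkhoffAverage (hT : MeasurePreserving T μ μ) {f : M → ℝ} (hf : Integrable f μ)
    {N : ℕ} (hN : N ≠ 0) : ∫ x, birkhoffAverage ℝ T f N x ∂μ = ∫ x, f x ∂μ := by
  have hi (k : ℕ) : Integrable (fun x => f (T^[k] x)) μ :=
    (hT.iterate k).integrable_comp_of_integrable hf
  have h (k : ℕ) : ∫ x, f (T^[k] x) ∂μ = ∫ x, f x ∂μ := by
    have hk := hT.iterate k
    conv_rhs => rw [← hk.map_eq]
    rw [integral_map hk.aemeasurable]
    rw [hk.map_eq]
    exact hf.aestronglyMeasurable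
  simp only [birkhoffAverage, birkhoffSum, smul_eq_mul]
  rw [integral_const_mul, integral_finsetSum _ fun k _ => hi k]
  simp only [h, Finset.sum_const, Finset.card_range, nsmul_eq_mul]
  field_simp

theorem measurable_birkhoffAverage (hT : Measurable T) {f : M → ℝ} (hf : Measurable f) (N : ℕ) :
    Measurable (birkhoffAverage ℝ T f N) := by
  change Measurable fun x => (N : ℝ)⁻¹ * ∑ k ∈ Finset.range N, f (T^[k] x)
  exact (Finset.measurable_fun_sum _ fun k _ => hf.comp (hT.iterate k)).const_mul _

/-- The mean ergodic theorem in `L¹` for a bounded function and an ergodic transformation. -/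
theorem tendsto_lintegral_birkhoffAverage_sub [IsProbabilityMeasure μ] (hT : Ergodic T μ)
    {f : M → ℝ} (hfm : Measurable f) (hf : MemLp f 2 μ) :
    Tendsto (fun N : ℕ => ∫⁻ x, ‖birkhoffAverage ℝ T f N x - ∫ y, f y ∂μ‖ₑ ∂μ) atTop (𝓝 0) := by
  have hTm : MeasurePreserving T μ μ := hT.toMeasurePreserving
  let U : Lp ℝ 2 μ →L[ℝ] Lp ℝ 2 μ := (Lp.compMeasurePreservingₗᵢ ℝ T hTm).toContinuousLinearMap
  have hU : ‖U‖ ≤ 1 := LinearIsometry.norm_toContinuousLinearMap_le _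
  have hUa (g : Lp ℝ 2 μ) : U g = Lp.compMeasurePreserving T hTm g := rfl
  let g : Lp ℝ 2 μ := hf.toLp f
  -- Von Neumann's theorem for the Koopman operator `U`: the averages converge in `L²` to the
  -- projection `p` onto the fixed vectors, and ergodicity makes a fixed vector constant.
  have hlim := U.tendsto_birkhoffAverage_orthogonalProjection hU g
  set p : Lp ℝ 2 μ :=
    ((U.eqLocus (1 : Lp ℝ 2 μ →L[ℝ] Lp ℝ 2 μ)).orthogonalProjectionOnto g : Lp ℝ 2 μ) with hp
  have hpfix : U p = p :=
    ((U.eqLocus (1 : Lp ℝ 2 μ →L[ℝ] Lp ℝ 2 μ)).orthogonalProjectionOnto g).2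
  have hpc : ∃ c : ℝ, p =ᵐ[μ] fun _ => c := by
    refine hT.ae_eq_const_of_ae_eq_comp_ae (Lp.aestronglyMeasurable p) ?_
    have := Lp.coeFn_compMeasurePreserving p hTm
    rw [← hUa, hpfix] at this
    exact this.symm
  obtain ⟨c, hc⟩ := hpc
  have hUit (k : ℕ) : (U^[k] g : Lp ℝ 2 μ) =ᵐ[μ] fun x => f (T^[k] x) := by
    induction k with
    | zero => exact hf.coeFn_toLp
    | succ k ih =>
      rw [Function.iterate_succ_apply', hUa]
      refine (Lp.coeFn_compMeasurePreserving _ hTm).trans ?_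
      have := hTm.quasiMeasurePreserving.ae_eq_comp ih
      refine this.trans (Eventually.of_forall fun x => ?_)
      simp [Function.iterate_succ_apply]
  have hav (N : ℕ) : (birkhoffAverage ℝ U _root_.id N g : Lp ℝ 2 μ)
      =ᵐ[μ] birkhoffAverage ℝ T f N := by
    have h1 : ∀ᵐ x ∂μ, ∀ k, (U^[k] g : Lp ℝ 2 μ) x = f (T^[k] x) := ae_all_iff.2 hUit
    have h2 := Lp.coeFn_smul ((N : ℝ)⁻¹) (∑ k ∈ Finset.range N, U^[k] g)
    have h3 := Lp.coeFn_finsetSum (Finset.range N) (fun k => U^[k] g)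
    filter_upwards [h1, h2, h3] with x hx1 hx2 hx3
    simp only [birkhoffAverage, birkhoffSum, id]
    rw [hx2, Pi.smul_apply, hx3]
    simp only [Finset.sum_apply, hx1]
  have hL2 : Tendsto (fun N : ℕ => eLpNorm (fun x => birkhoffAverage ℝ T f N x - c) 2 μ)
      atTop (𝓝 0) := by
    rw [Lp.tendsto_Lp_iff_tendsto_eLpNorm'] at hlim
    refine hlim.congr fun N => ?_
    refine eLpNorm_congr_ae ?_
    filter_upwards [hav N, hc] with x h1 h2
    rw [Pi.sub_apply, h1]
    congr 1
  have hm (N : ℕ) := measurable_birkhoffAverage hTm.measurable hfm N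
  have hL1 : Tendsto (fun N : ℕ => ∫⁻ x, ‖birkhoffAverage ℝ T f N x - c‖ₑ ∂μ) atTop (𝓝 0) := by
    refine tendsto_of_tendsto_of_tendsto_of_le_of_le tendsto_const_nhds hL2 (fun _ => zero_le) ?_
    intro N
    have := eLpNorm_le_eLpNorm_of_exponent_le (μ := μ) (p := 1) (q := 2)
      (f := fun x => birkhoffAverage ℝ T f N x - c) (by norm_num)
      ((hm N).sub_const c).aestronglyMeasurable
    simpa [eLpNorm_one_eq_lintegral_enorm] using this
  have hfi : Integrable f μ := hf.integrable (by norm_num)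
  -- Every average has the same integral as `f`, and integrals pass to `L¹` limits.
  have hcf : c = ∫ y, f y ∂μ := by
    have hle : ∀ᶠ N : ℕ in atTop, ‖(∫ y, f y ∂μ) - c‖ₑ
        ≤ ∫⁻ x, ‖birkhoffAverage ℝ T f N x - c‖ₑ ∂μ := by
      filter_upwards [eventually_ne_atTop 0] with N hN
      have hbi : Integrable (birkhoffAverage ℝ T f N) μ := by
        have hi (k : ℕ) : Integrable (fun x => f (T^[k] x)) μ :=
          (hTm.iterate k).integrable_comp_of_integrable hfi
        exact (integrable_finsetSum _ fun k _ => hi k).smul ((N : ℝ)⁻¹)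
      have h1 : (∫ y, f y ∂μ) - c = ∫ x, (birkhoffAverage ℝ T f N x - c) ∂μ := by
        rw [integral_sub hbi (integrable_const c), integral_birkhoffAverage hTm hfi hN]
        simp
      rw [h1]
      exact enorm_integral_le_lintegral_enorm _
    have h0 : ‖(∫ y, f y ∂μ) - c‖ₑ ≤ 0 := ge_of_tendsto hL1 hle
    have := enorm_eq_zero.1 (le_antisymm h0 zero_le)
    linarith
  rw [← hcf]
  exact hL1

/-- A sequence of countably many `L¹`-null sequences has a common a.e. null subsequence. -/
theorem exists_subseq_ae_tendsto_zero (u : ℕ → ℕ → M → ℝ)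
    (hm : ∀ j N, Measurable (u j N))
    (hu : ∀ j, Tendsto (fun N => ∫⁻ x, ‖u j N x‖ₑ ∂μ) atTop (𝓝 0)) :
    ∃ N : ℕ → ℕ, ∀ᵐ x ∂μ, ∀ j, Tendsto (fun k => u j (N k) x) atTop (𝓝 0) := by
  -- Diagonal choice: at stage `k` only the first `k` sequences are controlled, so for fixed `j` the
  -- bound starts at `k = j + 1`.
  have hN (k : ℕ) : ∃ N : ℕ, ∀ j ∈ Finset.range k, ∫⁻ x, ‖u j N x‖ₑ ∂μ ≤ (2⁻¹ : ℝ≥0∞) ^ k := by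
    have : ∀ᶠ N : ℕ in atTop, ∀ j ∈ Finset.range k, ∫⁻ x, ‖u j N x‖ₑ ∂μ ≤ (2⁻¹ : ℝ≥0∞) ^ k := by
      rw [Filter.eventually_all_finset]
      intro j _
      have hpos : (0 : ℝ≥0∞) < 2⁻¹ ^ k := ENNReal.pow_pos (by simp) k
      exact (hu j).eventually (eventually_le_nhds hpos)
    exact this.exists
  choose N hN using hN
  refine ⟨N, ae_all_iff.2 fun j => ?_⟩
  -- Summable `L¹` norms make the series of absolute values finite almost everywhere, so its terms
  -- tend to zero.
  have hsum : ∑' k, ∫⁻ x, ‖u j (N (k + (j + 1))) x‖ₑ ∂μ ≠ ⊤ := by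
    have hle : ∑' k, ∫⁻ x, ‖u j (N (k + (j + 1))) x‖ₑ ∂μ ≤ ∑' k : ℕ, (2⁻¹ : ℝ≥0∞) ^ k := by
      refine ENNReal.tsum_le_tsum fun k => ?_
      refine (hN (k + (j + 1)) j (Finset.mem_range.2 (by omega))).trans ?_
      exact pow_le_pow_of_le_one zero_le (by simp) (by omega)
    refine ne_top_of_le_ne_top ?_ hle
    rw [ENNReal.tsum_geometric]
    simp
  rw [← lintegral_tsum fun k => ((hm j _).enorm).aemeasurable] at hsum
  have hfin := ae_lt_top (Measurable.tsum fun k => (hm j (N (k + (j + 1)))).enorm) hsum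
  filter_upwards [hfin] with x hx
  have h0 := ENNReal.tendsto_atTop_zero_of_tsum_ne_top hx.ne
  rw [← tendsto_add_atTop_iff_nat (j + 1)]
  rw [tendsto_zero_iff_norm_tendsto_zero]
  have := (ENNReal.tendsto_toReal ENNReal.zero_ne_top).comp h0
  simpa [Function.comp_def] using this

end Ergodic

/-! ### Generic points -/

section Generic

variable {M : Type*} [TopologicalSpace M] [CompactSpace M]

theorem abs_birkhoffAverage_sub_le (T : M → M) (f g : C(M, ℝ)) (N : ℕ) (x : M) :
    |birkhoffAverage ℝ T f N x - birkhoffAverage ℝ T g N x| ≤ ‖f - g‖ := by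
  have h : birkhoffAverage ℝ T f N x - birkhoffAverage ℝ T g N x
      = (N : ℝ)⁻¹ * ∑ k ∈ Finset.range N, (f - g) (T^[k] x) := by
    simp [birkhoffAverage, birkhoffSum, Finset.sum_sub_distrib, mul_sub]
  rw [h, abs_mul, abs_of_nonneg (by positivity)]
  have h2 : |∑ k ∈ Finset.range N, (f - g) (T^[k] x)| ≤ N * ‖f - g‖ := by
    refine (Finset.abs_sum_le_sum_abs _ _).trans ?_
    refine (Finset.sum_le_sum fun k _ => (f - g).norm_coe_le_norm (T^[k] x)).trans ?_
    simp
  rcases Nat.eq_zero_or_pos N with rfl | hN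
  · simp
  · calc (N : ℝ)⁻¹ * |∑ k ∈ Finset.range N, (f - g) (T^[k] x)|
        ≤ (N : ℝ)⁻¹ * (N * ‖f - g‖) := by gcongr
      _ = ‖f - g‖ := by field_simp

variable [MeasurableSpace M] [BorelSpace M] {μ : Measure M} {T : M → M}

/-- The points whose Birkhoff averages along the times `N k` converge to the integral for `μ`, for
all continuous observables. -/
def genericPoints (μ : Measure M) (T : M → M) (N : ℕ → ℕ) : Set M :=
  {x | ∀ f : C(M, ℝ), Tendsto (fun k => birkhoffAverage ℝ T f (N k) x) atTop (𝓝 (∫ y, f y ∂μ))}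

/-- `C(M, ℝ)` is separable, so one subsequence serves a countable dense family, and uniform
approximation extends convergence to all continuous functions. A subsequence is enough, since
genericity is used only to recover `μ` from limits of averages. -/
theorem exists_ae_mem_genericPoints [T2Space M] [SecondCountableTopology M]
    [IsProbabilityMeasure μ] (hT : Ergodic T μ) :
    ∃ N : ℕ → ℕ, ∀ᵐ x ∂μ, x ∈ genericPoints μ T N := by
  let F : ℕ → C(M, ℝ) := TopologicalSpace.denseSeq C(M, ℝ)
  have hF : DenseRange F := TopologicalSpace.denseRange_denseSeq _
  have hi (f : C(M, ℝ)) : Integrable f μ := by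
    refine (integrable_const ‖f‖).mono' f.continuous.aestronglyMeasurable ?_
    exact Eventually.of_forall fun x => f.norm_coe_le_norm x
  obtain ⟨N, hN⟩ := exists_subseq_ae_tendsto_zero (μ := μ)
    (fun j N x => birkhoffAverage ℝ T (F j) N x - ∫ y, F j y ∂μ)
    (fun j N => (measurable_birkhoffAverage hT.measurable (F j).continuous.measurable N).sub_const _)
    (fun j => tendsto_lintegral_birkhoffAverage_sub hT (F j).continuous.measurable
      (MemLp.of_bound (F j).continuous.aestronglyMeasurable ‖F j‖
        (Eventually.of_forall fun x => (F j).norm_coe_le_norm x)))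
  refine ⟨N, ?_⟩
  filter_upwards [hN] with x hx f
  rw [Metric.tendsto_atTop]
  intro ε hε
  obtain ⟨j, hj⟩ := hF.exists_dist_lt f (show (0 : ℝ) < ε / 3 by positivity)
  rw [dist_eq_norm] at hj
  obtain ⟨k₀, hk₀⟩ := (Metric.tendsto_atTop.1 (hx j)) (ε / 3) (by positivity)
  refine ⟨k₀, fun k hk => ?_⟩
  have h1 := hk₀ k hk
  rw [Real.dist_eq, sub_zero] at h1
  have h2 := abs_birkhoffAverage_sub_le T f (F j) (N k) x
  have h3 : |(∫ y, f y ∂μ) - ∫ y, F j y ∂μ| ≤ ‖f - F j‖ := by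
    rw [← integral_sub (hi f) (hi (F j))]
    refine (norm_integral_le_of_norm_le_const (C := ‖f - F j‖)
      (Eventually.of_forall fun y => (f - F j).norm_coe_le_norm y)).trans ?_
    simp
  rw [Real.dist_eq]
  rw [abs_lt] at h1 ⊢
  rw [abs_le] at h2 h3
  constructor <;> linarith

/-- A homeomorphism that commutes with `T` and maps a generic point to a generic point preserves
the measure. -/
theorem map_eq_of_mem_genericPoints [T2Space M] [SecondCountableTopology M]
    [IsProbabilityMeasure μ] {N : ℕ → ℕ} {g : M → M} (hg : Continuous g)
    (hcomm : Function.Commute g T) {x : M} (hx : x ∈ genericPoints μ T N)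
    (hgx : g x ∈ genericPoints μ T N) : μ.map g = μ := by
  have : IsProbabilityMeasure (μ.map g) := Measure.isProbabilityMeasure_map hg.aemeasurable
  let _ := TopologicalSpace.metrizableSpaceMetric M
  refine ext_of_forall_integral_eq_of_IsFiniteMeasure fun f => ?_
  rw [integral_map hg.aemeasurable f.continuous.aestronglyMeasurable]
  have h1 := hgx f.toContinuousMap
  -- Since `g` commutes with `T`, the averages of `f ∘ g` at `x` are those of `f` at `g x`.
  have h2 := hx (f.toContinuousMap.comp ⟨g, hg⟩)
  refine tendsto_nhds_unique h2 (h1.congr fun k => ?_)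
  simp only [birkhoffAverage, birkhoffSum]
  congr 1
  refine Finset.sum_congr rfl fun i _ => ?_
  have := hcomm.iterate_right i x
  simp [this]

end Generic

/-! ### Local sections of flows and subordinate partitions -/

section Sections

/-- Whitney–Bebutov local sections of a continuous flow, in the form of a continuous projection to a
point of the orbit that is locally constant along orbits. -/
theorem exists_local_section {M : Type*} [MetricSpace M] (φ : Flow ℝ M) {x₀ : M}
    (h : ∃ t, φ t x₀ ≠ x₀) :
    ∃ W : Set M, IsOpen W ∧ x₀ ∈ W ∧ ∃ p : M → M, ContinuousOn p W ∧ (∀ z ∈ W, ∃ t, p z = φ t z) ∧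
      ∀ z ∈ W, ∀ᶠ t in 𝓝 (0 : ℝ), φ t z ∈ W → p (φ t z) = p z := by
  obtain ⟨T, hT⟩ := h
  have hφ : Continuous fun q : ℝ × M => φ q.1 q.2 := φ.continuous continuous_fst continuous_snd
  let f : ℝ → M → ℝ := fun u z => dist (φ u z) x₀
  have hf : Continuous fun q : ℝ × M => f q.1 q.2 := hφ.dist continuous_const
  have hfz (z : M) : Continuous fun u => f u z := hf.comp (by fun_prop : Continuous fun u => (u, z))
  -- Averaging the distance to `x₀` over a time `T` makes it differentiable along orbits. The
  -- derivative at `x₀` is `dist (φ T x₀) x₀ > 0`, so the level set of `F` through `x₀` is a local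
  -- section.
  let F : M → ℝ := fun z => ∫ u in (0 : ℝ)..T, f u z
  have hF : Continuous F := by
    apply intervalIntegral.continuous_parametric_intervalIntegral_of_continuous'
    exact hf.comp continuous_swap
  let K : ℝ → M → ℝ := fun t z => F (φ t z)
  have hK : Continuous fun q : ℝ × M => K q.1 q.2 := hF.comp hφ
  have hKder (t : ℝ) (z : M) : HasDerivAt (fun t => K t z) (f (t + T) z - f t z) t := by
    have hKeq : (fun t => K t z) =
        fun t => (∫ u in (0 : ℝ)..(t + T), f u z) - ∫ u in (0 : ℝ)..t, f u z := by
      funext t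
      have h1 : K t z = ∫ u in (0 : ℝ)..T, f (u + t) z := by
        simp only [K, F, f, φ.map_add]
      rw [h1, intervalIntegral.integral_comp_add_right (fun u => f u z), zero_add, add_comm T t]
      rw [eq_sub_iff_add_eq, add_comm]
      exact intervalIntegral.integral_add_adjacent_intervals ((hfz z).intervalIntegrable _ _)
        ((hfz z).intervalIntegrable _ _)
    rw [hKeq]
    have h2 (s : ℝ) : HasDerivAt (fun t => ∫ u in (0 : ℝ)..t, f u z) (f s z) s :=
      intervalIntegral.integral_hasDerivAt_right ((hfz z).intervalIntegrable _ _)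
        ((hfz z).stronglyMeasurableAtFilter _ _) (hfz z).continuousAt
    exact ((h2 (t + T)).comp_add_const t T).sub (h2 t)
  have hD : Continuous fun q : ℝ × M => f (q.1 + T) q.2 - f q.1 q.2 := by
    refine Continuous.sub ?_ hf
    exact hf.comp (by fun_prop : Continuous fun q : ℝ × M => (q.1 + T, q.2))
  have hD0 : 0 < f (0 + T) x₀ - f 0 x₀ := by
    simpa [f] using hT
  have hev : ∀ᶠ q in 𝓝 (0 : ℝ) ×ˢ 𝓝 x₀, 0 < f (q.1 + T) q.2 - f q.1 q.2 := by
    rw [← nhds_prod_eq]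
    exact hD.continuousAt.eventually (lt_mem_nhds hD0)
  obtain ⟨pa, hpa, pb, hpb, hpab⟩ := eventually_prod_iff.1 hev
  obtain ⟨δ, hδ, hδa⟩ := Metric.eventually_nhds_iff.1 hpa
  obtain ⟨W₀, hW₀, hW₀o, hxW₀⟩ := eventually_nhds_iff.1 hpb
  let ε := δ / 2
  have hε : 0 < ε := half_pos hδ
  have hmono (z : M) (hz : z ∈ W₀) : StrictMonoOn (fun t => K t z) (Set.Icc (-ε) ε) := by
    refine strictMonoOn_of_deriv_pos (convex_Icc _ _)
      (fun t _ => (hKder t z).continuousAt.continuousWithinAt) ?_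
    intro t ht
    rw [interior_Icc] at ht
    rw [(hKder t z).deriv]
    refine hpab (hδa ?_) (hW₀ z hz)
    rw [Real.dist_eq, sub_zero, abs_lt]
    constructor <;> linarith [ht.1, ht.2, half_lt_self hδ, show ε = δ / 2 from rfl]
  let c := F x₀
  -- On `W` the increasing function `K · z` passes the value `c` between times `-ε` and `ε`; the
  -- crossing time is `τ z`.
  let W : Set M := W₀ ∩ {z | K (-ε) z < c} ∩ {z | c < K ε z}
  have hKt (t : ℝ) : Continuous fun z => K t z :=
    hK.comp (by fun_prop : Continuous fun z : M => (t, z))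
  have hK0 : K 0 x₀ = c := by simp [K, c]
  have hWo : IsOpen W := (hW₀o.inter (isOpen_lt (hKt _) continuous_const)).inter
    (isOpen_lt continuous_const (hKt _))
  have hex (z : M) : ∃ t, z ∈ W → t ∈ Set.Ioo (-ε) ε ∧ K t z = c := by
    by_cases hz : z ∈ W
    · obtain ⟨t, ht, htc⟩ := intermediate_value_Ioo (by linarith : -ε ≤ ε)
        (fun t _ => (hKder t z).continuousAt.continuousWithinAt) ⟨hz.1.2, hz.2⟩
      exact ⟨t, fun _ => ⟨ht, htc⟩⟩
    · exact ⟨0, fun h => absurd h hz⟩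
  choose τ hτ using hex
  have huniq (z : M) (hz : z ∈ W) (t : ℝ) (ht : t ∈ Set.Icc (-ε) ε) (htc : K t z = c) : τ z = t :=
    (hmono z hz.1.1).injOn (Set.Ioo_subset_Icc_self (hτ z hz).1) ht ((hτ z hz).2.trans htc.symm)
  -- By monotonicity, `τ` is bounded on either side by the sign of `K - c` at a fixed time, and this
  -- sign persists at nearby points.
  have hτc : ContinuousOn τ W := by
    intro z hz
    have hτz := hτ z hz
    rw [ContinuousWithinAt, tendsto_order]
    constructor
    · intro a ha
      have ha' : max a (-ε) < τ z := max_lt ha hτz.1.1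
      have hmem : max a (-ε) ∈ Set.Icc (-ε) ε := ⟨le_max_right _ _, (ha'.trans hτz.1.2).le⟩
      have hlt : K (max a (-ε)) z < c := by
        rw [← hτz.2]
        exact hmono z hz.1.1 hmem (Set.Ioo_subset_Icc_self hτz.1) ha'
      filter_upwards [self_mem_nhdsWithin,
        mem_nhdsWithin_of_mem_nhds ((hKt (max a (-ε))).continuousAt.eventually (gt_mem_nhds hlt))]
        with y hy hy'
      rw [← (hτ y hy).2] at hy'
      exact (le_max_left _ _).trans_lt (((hmono y hy.1.1).lt_iff_lt hmem
        (Set.Ioo_subset_Icc_self (hτ y hy).1)).1 hy')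
    · intro b hb
      have hb' : τ z < min b ε := lt_min hb hτz.1.2
      have hmem : min b ε ∈ Set.Icc (-ε) ε := ⟨(hτz.1.1.trans hb').le, min_le_right _ _⟩
      have hlt : c < K (min b ε) z := by
        rw [← hτz.2]
        exact hmono z hz.1.1 (Set.Ioo_subset_Icc_self hτz.1) hmem hb'
      filter_upwards [self_mem_nhdsWithin,
        mem_nhdsWithin_of_mem_nhds ((hKt (min b ε)).continuousAt.eventually (lt_mem_nhds hlt))]
        with y hy hy'
      rw [← (hτ y hy).2] at hy'
      exact (((hmono y hy.1.1).lt_iff_lt (Set.Ioo_subset_Icc_self (hτ y hy).1) hmem).1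
        hy').trans_le (min_le_left _ _)
  refine ⟨W, hWo, ⟨⟨hxW₀, ?_⟩, ?_⟩, fun z => φ (τ z) z, ?_, fun z _ => ⟨τ z, rfl⟩, ?_⟩
  · change K (-ε) x₀ < c
    rw [← hK0]
    exact hmono x₀ hxW₀ ⟨le_rfl, by linarith⟩ ⟨by linarith, hε.le⟩ (by linarith)
  · change c < K ε x₀
    rw [← hK0]
    exact hmono x₀ hxW₀ ⟨by linarith, hε.le⟩ ⟨by linarith, le_rfl⟩ hε
  · exact hφ.comp_continuousOn (hτc.prodMk continuousOn_id)
  · intro z hz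
    have hτz := (hτ z hz).1
    -- For small `t` the time `τ z - t` is still in the window, so uniqueness makes it the crossing
    -- time of `φ t z`: both points reach the section at the same place.
    have h1 : ∀ᶠ t in 𝓝 (0 : ℝ), τ z - t ∈ Set.Ioo (-ε) ε := by
      have hc : ContinuousAt (fun t : ℝ => τ z - t) 0 := by fun_prop
      refine hc.eventually (Ioo_mem_nhds ?_ ?_) <;> simp [hτz.1, hτz.2]
    filter_upwards [h1] with t ht htW
    have hadd : φ (τ z - t) (φ t z) = φ (τ z) z := by
      rw [← φ.map_add, sub_add_cancel]
    have : τ (φ t z) = τ z - t := by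
      refine huniq _ htW _ (Set.Ioo_subset_Icc_self ht) ?_
      change F (φ (τ z - t) (φ t z)) = c
      rw [hadd]
      exact (hτ z hz).2
    change φ (τ (φ t z)) (φ t z) = φ (τ z) z
    rw [this, hadd]

/-- The measurable partition into the fibers of a measurable map. -/
def fiberPartition {M Y : Type*} [MeasurableSpace M] [mY : MeasurableSpace Y]
    [MeasurableSpace.CountablyGenerated Y] (f : M → Y) (hf : Measurable f) :
    MeasurablePartition M where
  sigma := mY.comap f
  sigma_le := hf.comap_le
  countablyGenerated := MeasurableSpace.CountablyGenerated.comap f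

theorem cell_fiberPartition {M Y : Type*} [MeasurableSpace M] [mY : MeasurableSpace Y]
    [MeasurableSpace.CountablyGenerated Y] [MeasurableSingletonClass Y] (f : M → Y)
    (hf : Measurable f) (x : M) : (fiberPartition f hf).cell x = {y | f y = f x} := by
  ext y
  simp only [MeasurablePartition.cell, measurableAtom, Set.mem_iInter, Set.mem_ofPred_eq]
  constructor
  · intro h
    exact h (f ⁻¹' {f x}) rfl ⟨{f x}, measurableSet_singleton _, rfl⟩
  · rintro h s hx ⟨t, ht, rfl⟩
    simpa [h] using hx

/-- A continuous flow without fixed points has a measurable partition into pieces of orbits that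
contain, for almost every point, a neighborhood of the point in its orbit. -/
theorem exists_partition_subordinate_flow {M : Type*} [TopologicalSpace M] [CompactSpace M]
    [T2Space M] [SecondCountableTopology M] [MeasurableSpace M] [BorelSpace M]
    (φ : Flow ℝ M) (hφ : ∀ x, ∃ t, φ t x ≠ x) (μ : Measure M) [IsFiniteMeasure μ] :
    ∃ η : MeasurablePartition M, ∀ᵐ x ∂μ,
      η.cell x ⊆ Set.range (fun t => φ t x) ∧ ∀ᶠ t in 𝓝 (0 : ℝ), φ t x ∈ η.cell x := by
  let _ := TopologicalSpace.metrizableSpaceMetric M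
  -- The neighborhoods are shrunk to balls with null frontier, so that almost every point outside
  -- `W` has a neighborhood outside `W`.
  have hloc (x₀ : M) : ∃ W : Set M, IsOpen W ∧ x₀ ∈ W ∧ μ (frontier W) = 0 ∧ ∃ p : M → M,
      ContinuousOn p W ∧ (∀ z ∈ W, ∃ t, p z = φ t z) ∧
        ∀ z ∈ W, ∀ᶠ t in 𝓝 (0 : ℝ), φ t z ∈ W → p (φ t z) = p z := by
    obtain ⟨W, hW, hxW, p, hp, hpt, hpc⟩ := exists_local_section φ (hφ x₀)
    obtain ⟨r, hr, hrW⟩ := Metric.isOpen_iff.1 hW x₀ hxW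
    obtain ⟨r', hr', hfr⟩ := exists_null_frontier_thickening μ {x₀} hr
    rw [Metric.thickening_singleton] at hfr
    have hsub : Metric.ball x₀ r' ⊆ W := (Metric.ball_subset_ball hr'.2.le).trans hrW
    refine ⟨Metric.ball x₀ r', Metric.isOpen_ball, Metric.mem_ball_self hr'.1, hfr, p,
      hp.mono hsub, fun z hz => hpt z (hsub hz), fun z hz => ?_⟩
    exact (hpc z (hsub hz)).mono fun t ht hzt => ht (hsub hzt)
  choose W hWo hxW hWf p hp hpt hpc using hloc
  obtain ⟨s, hs⟩ := isCompact_univ.elim_finite_subcover W hWo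
    (fun x _ => Set.mem_iUnion.2 ⟨x, hxW x⟩)
  classical
  -- The label of `z` records, for each section of a finite cover, whether `z` lies in its domain
  -- and where it projects. The value off the domain is an arbitrary constant. Points with equal
  -- labels share a projection and hence an orbit.
  let f : M → s → M × Prop := fun z i => (if z ∈ W i then p i z else (i : M), z ∈ W i)
  have hf : Measurable f := by
    refine measurable_pi_lambda _ fun i => Measurable.prodMk ?_ ?_
    · refine measurable_of_restrict_of_restrict_compl (hWo i).measurableSet ?_ ?_
      · have : (W i).domRestrict (fun z => if z ∈ W i then p i z else (i : M)) = (W i).domRestrict (p i) := by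
          funext z
          exact if_pos z.2
        rw [this]
        exact (continuousOn_iff_continuous_domRestrict.1 (hp i)).measurable
      · have : (W i)ᶜ.domRestrict (fun z => if z ∈ W i then p i z else (i : M)) = fun _ => (i : M) := by
          funext z
          exact if_neg z.2
        rw [this]
        exact measurable_const
    · exact measurableSet_setOfPred.1 (hWo i).measurableSet
  refine ⟨fiberPartition f hf, ?_⟩
  have hfr : ∀ᵐ x ∂μ, ∀ i : s, x ∉ frontier (W i) :=
    ae_all_iff.2 fun i => measure_eq_zero_iff_ae_notMem.1 (hWf i)
  filter_upwards [hfr] with x hx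
  rw [cell_fiberPartition]
  constructor
  · intro y hy
    obtain ⟨i, hi, hxi⟩ : ∃ i, ∃ _ : i ∈ s, x ∈ W i := by
      have := hs (Set.mem_univ x)
      simpa using this
    have hyi := congrFun hy ⟨i, hi⟩
    simp only [f, Prod.mk.injEq, hxi, if_true, eq_iff_iff, iff_true] at hyi
    obtain ⟨hyi1, hyi2⟩ := hyi
    rw [if_pos hyi2] at hyi1
    obtain ⟨t, ht⟩ := hpt i x hxi
    obtain ⟨t', ht'⟩ := hpt i y hyi2
    refine ⟨-t' + t, ?_⟩
    change φ (-t' + t) x = y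
    rw [φ.map_add, ← ht, ← hyi1, ht', ← φ.map_add, neg_add_cancel, φ.map_zero_apply]
  · have hi (i : s) : ∀ᶠ t in 𝓝 (0 : ℝ), f (φ t x) i = f x i := by
      have hct : Tendsto (fun t => φ t x) (𝓝 0) (𝓝 x) := by
        have : Continuous fun t => φ t x := φ.continuous continuous_id continuous_const
        have h0 := this.tendsto 0
        rwa [φ.map_zero_apply] at h0
      by_cases hxi : x ∈ W i
      · filter_upwards [hpc i x hxi, hct.eventually ((hWo i).mem_nhds hxi)] with t h1 (h2 : φ t x ∈ W i)
        simp only [f, hxi, h2, if_true, h1 h2]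
      · have hxc : x ∉ closure (W i) := by
          intro hc
          exact hx i ⟨hc, by rwa [(hWo i).interior_eq]⟩
        filter_upwards [hct.eventually (isClosed_closure.isOpen_compl.mem_nhds hxc)] with t ht
        have : φ t x ∉ W i := fun h => ht (subset_closure h)
        simp only [f, hxi, this, if_false]
    exact (eventually_all.2 hi).mono fun t ht => funext ht

end Sections

/-! ### Bracket and adjoint action for a local group law -/

section LocalCalculus

variable {E : Type*} [NormedAddCommGroup E] [NormedSpace ℝ E]

theorem eventually_fderiv_partial_snd {f : E × E → E} {e : E} (hf : ContDiffAt ℝ 2 f (e, e)) (w : E) :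
    ∀ᶠ x in 𝓝 e, fderiv ℝ (fun y => f (x, y)) e w = fderiv ℝ f (x, e) (0, w) := by
  have h1 : ∀ᶠ q in 𝓝 (e, e), DifferentiableAt ℝ f q :=
    (hf.eventually (by simp)).mono fun q hq => hq.differentiableAt (by norm_num)
  have hc : Tendsto (fun x : E => (x, e)) (𝓝 e) (𝓝 (e, e)) := by
    exact (by fun_prop : Continuous fun x : E => (x, e)).tendsto e
  filter_upwards [hc.eventually h1] with x hx
  have h2 : HasFDerivAt (fun y : E => (x, y)) (ContinuousLinearMap.inr ℝ E E) e :=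
    hasFDerivAt_prodMk_right x e
  have h3 : HasFDerivAt (fun y => f (x, y)) _ e := hx.hasFDerivAt.comp e h2
  rw [h3.fderiv]
  simp

theorem hasFDerivAt_fderiv_comp {f : E × E → E} {e : E} (hf : ContDiffAt ℝ 2 f (e, e))
    {u : E → E × E} {u' : E →L[ℝ] E × E} (hu : HasFDerivAt u u' e) (hue : u e = (e, e)) :
    HasFDerivAt (fun x => fderiv ℝ f (u x)) ((fderiv ℝ (fderiv ℝ f) (e, e)).comp u') e := by
  have h1 : ContDiffAt ℝ 1 (fderiv ℝ f) (e, e) := hf.fderiv_right (by norm_num)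
  have h2 := (h1.differentiableAt (by norm_num)).hasFDerivAt
  rw [← hue] at h2 ⊢
  exact h2.comp e hu

/-- Let `m` be a local group law with unit `e`, and let `c` be its conjugation. The derivative of the
adjoint action is the bracket of the left-invariant vector fields. -/
theorem fderiv_local_adjoint {m c : E × E → E} {e : E} (hm : ContDiffAt ℝ 2 m (e, e))
    (hc : ContDiffAt ℝ 2 c (e, e)) (hmc : ∀ᶠ q in 𝓝 (e, e), m (c q, q.1) = m q)
    (hmr : ∀ᶠ x in 𝓝 e, m (x, e) = x) (hml : ∀ᶠ y in 𝓝 e, m (e, y) = y)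
    (hcr : ∀ᶠ x in 𝓝 e, c (x, e) = e) (hcl : ∀ᶠ y in 𝓝 e, c (e, y) = y) (v w : E) :
    DifferentiableAt ℝ (fun x => fderiv ℝ (fun y => c (x, y)) e w) e ∧
      fderiv ℝ (fun x => fderiv ℝ (fun y => c (x, y)) e w) e v =
        VectorField.lieBracket ℝ (fun x => fderiv ℝ (fun y => m (x, y)) e v)
          (fun x => fderiv ℝ (fun y => m (x, y)) e w) e := by
  set D := fderiv ℝ (fderiv ℝ m) (e, e) with hD
  have hsymm (a b : E × E) : D a b = D b a :=
    (hm.isSymmSndFDerivAt (by simp)).eq a b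
  have hinl : HasFDerivAt (fun x : E => (x, e)) (ContinuousLinearMap.inl ℝ E E) e :=
    hasFDerivAt_prodMk_left e e
  have hinr : HasFDerivAt (fun x : E => (e, x)) (ContinuousLinearMap.inr ℝ E E) e :=
    hasFDerivAt_prodMk_right e e
  -- the left-invariant vector fields
  have hV (a : E) : HasFDerivAt (fun x => fderiv ℝ (fun y => m (x, y)) e a)
      ((D.comp (ContinuousLinearMap.inl ℝ E E)).flip (0, a)) e := by
    have h1 := (hasFDerivAt_fderiv_comp hm hinl rfl).clm_apply (hasFDerivAt_const ((0 : E), a) e)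
    refine (h1.congr_of_eventuallyEq (eventually_fderiv_partial_snd hm a)).congr_fderiv ?_
    ext b
    simp [hD]
  have hVe (a : E) : fderiv ℝ (fun y => m (e, y)) e a = a := by
    have : (fun y => m (e, y)) =ᶠ[𝓝 e] id := hml
    rw [this.fderiv_eq, fderiv_id]
    rfl
  have hbr : VectorField.lieBracket ℝ (fun x => fderiv ℝ (fun y => m (x, y)) e v)
          (fun x => fderiv ℝ (fun y => m (x, y)) e w) e = D (v, 0) (0, w) - D (w, 0) (0, v) := by
    rw [VectorField.lieBracket, (hV w).fderiv, (hV v).fderiv, hVe, hVe]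
    simp
  -- the adjoint action
  set F : E → E := fun x => fderiv ℝ (fun y => c (x, y)) e w with hF
  have hFd : DifferentiableAt ℝ F e := by
    have h1 := (hasFDerivAt_fderiv_comp hc hinl rfl).clm_apply (hasFDerivAt_const ((0 : E), w) e)
    exact (h1.congr_of_eventuallyEq (eventually_fderiv_partial_snd hc w)).differentiableAt
  have hFe : F e = w := by
    have : (fun y => c (e, y)) =ᶠ[𝓝 e] id := hcl
    simp only [hF]
    rw [this.fderiv_eq, fderiv_id]
    rfl
  refine ⟨hFd, ?_⟩
  -- Differentiating `(x y x⁻¹) x = x y` in `y` at the unit.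
  have hkey : (fun x => fderiv ℝ m (e, x) (F x, 0)) =ᶠ[𝓝 e]
      fun x => fderiv ℝ (fun y => m (x, y)) e w := by
    have hl : Tendsto (fun x : E => (x, e)) (𝓝 e) (𝓝 (e, e)) :=
      (by fun_prop : Continuous fun x : E => (x, e)).tendsto e
    have hr : Tendsto (fun x : E => (e, x)) (𝓝 e) (𝓝 (e, e)) :=
      (by fun_prop : Continuous fun x : E => (e, x)).tendsto e
    have hdm : ∀ᶠ q in 𝓝 (e, e), DifferentiableAt ℝ m q :=
      (hm.eventually (by simp)).mono fun q hq => hq.differentiableAt (by norm_num)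
    have hdc : ∀ᶠ q in 𝓝 (e, e), DifferentiableAt ℝ c q :=
      (hc.eventually (by simp)).mono fun q hq => hq.differentiableAt (by norm_num)
    filter_upwards [hl.eventually hmc.eventually_nhds, hr.eventually hdm, hl.eventually hdc, hcr]
      with x h1 h2 h3 h4
    have h5 : (fun y => m (c (x, y), x)) =ᶠ[𝓝 e] fun y => m (x, y) := by
      have : Tendsto (fun y : E => (x, y)) (𝓝 e) (𝓝 (x, e)) :=
        (by fun_prop : Continuous fun y : E => (x, y)).tendsto e
      exact this.eventually h1
    rw [← h5.fderiv_eq]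
    have h6 : HasFDerivAt (fun y => c (x, y)) (fderiv ℝ (fun y => c (x, y)) e) e := by
      refine DifferentiableAt.hasFDerivAt ?_
      exact DifferentiableAt.comp e h3 (hasFDerivAt_prodMk_right x e).differentiableAt
    have h7 := h6.prodMk (hasFDerivAt_const x e)
    have h8 : HasFDerivAt m (fderiv ℝ m (e, x)) (c (x, e), x) := by
      rw [h4]
      exact h2.hasFDerivAt
    have h9 : HasFDerivAt (fun y => m (c (x, y), x)) _ e := h8.comp e h7
    rw [h9.fderiv]
    simp [hF]
  have hL := ((hasFDerivAt_fderiv_comp hm hinr rfl).clm_apply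
    (hFd.hasFDerivAt.prodMk (hasFDerivAt_const (0 : E) e)))
  -- Differentiating `hkey` in `x` gives `D (0, v) (w, 0) + F' v = D (v, 0) (0, w)`; symmetry of `D`
  -- turns this into the bracket formula `hbr`.
  have heq := (hL.congr_of_eventuallyEq hkey.symm).unique (hV w)
  have heqv := congrArg (fun L => L v) heq
  have hm1 (a : E) : fderiv ℝ m (e, e) (a, 0) = a := by
    have h1 : HasFDerivAt (fun x => m (x, e)) _ e :=
      HasFDerivAt.comp (f := fun x => (x, e)) e (hm.differentiableAt (by norm_num)).hasFDerivAt hinl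
    have h2 : (fun x => m (x, e)) =ᶠ[𝓝 e] id := hmr
    have h3 := (h1.congr_of_eventuallyEq h2.symm).unique (hasFDerivAt_id e)
    have := congrArg (fun L => L a) h3
    simpa using this
  simp only [← hD, add_apply, ContinuousLinearMap.comp_apply,
    ContinuousLinearMap.prod_apply, zero_apply, hm1, hFe,
    ContinuousLinearMap.flip_apply, ContinuousLinearMap.inr_apply,
    ContinuousLinearMap.inl_apply] at heqv
  rw [hbr, hsymm (w, 0) (0, v)]
  rw [eq_sub_iff_add_eq]
  exact heqv

end LocalCalculus

/-! ### The adjoint action of a Lie group in the chart at the identity -/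

section Adjoint

variable {n : ℕ} {G : Type*} [TopologicalSpace G] [ChartedSpace (EuclideanSpace ℝ (Fin n)) G]
  [Group G]

/-- The group law in the chart at the identity. -/
noncomputable def chartMul (n : ℕ) (G : Type*) [TopologicalSpace G]
    [ChartedSpace (EuclideanSpace ℝ (Fin n)) G] [Group G]
    (q : EuclideanSpace ℝ (Fin n) × EuclideanSpace ℝ (Fin n)) : EuclideanSpace ℝ (Fin n) :=
  extChartAt (𝓡 n) (1 : G)
    ((extChartAt (𝓡 n) (1 : G)).symm q.1 * (extChartAt (𝓡 n) (1 : G)).symm q.2)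

/-- Conjugation by `g` in the chart at the identity. -/
noncomputable def chartConj (n : ℕ) {G : Type*} [TopologicalSpace G]
    [ChartedSpace (EuclideanSpace ℝ (Fin n)) G] [Group G] (g : G)
    (y : EuclideanSpace ℝ (Fin n)) : EuclideanSpace ℝ (Fin n) :=
  extChartAt (𝓡 n) (1 : G) (g * (extChartAt (𝓡 n) (1 : G)).symm y * g⁻¹)

/-- The adjoint action of `g` on the tangent space at the identity. -/
noncomputable def adjoint (n : ℕ) {G : Type*} [TopologicalSpace G]
    [ChartedSpace (EuclideanSpace ℝ (Fin n)) G] [Group G] (g : G) :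
    EuclideanSpace ℝ (Fin n) →L[ℝ] EuclideanSpace ℝ (Fin n) :=
  fderiv ℝ (chartConj n g) (extChartAt (𝓡 n) (1 : G) 1)

theorem extChartAt_symm_one :
    (extChartAt (𝓡 n) (1 : G)).symm (extChartAt (𝓡 n) (1 : G) 1) = 1 :=
  extChartAt_to_inv (1 : G)

theorem adjoint_one : adjoint n (1 : G) = ContinuousLinearMap.id ℝ _ := by
  have : chartConj n (1 : G) =ᶠ[𝓝 (extChartAt (𝓡 n) (1 : G) 1)] id := by
    filter_upwards [extChartAt_target_mem_nhds (I := 𝓡 n) (1 : G)] with y hy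
    simp only [chartConj, one_mul, inv_one, mul_one, id]
    exact (extChartAt (𝓡 n) (1 : G)).right_inv hy
  rw [adjoint, this.fderiv_eq, fderiv_id]

theorem chartConj_one (g : G) :
    chartConj n g (extChartAt (𝓡 n) (1 : G) 1) = extChartAt (𝓡 n) (1 : G) 1 := by
  simp [chartConj]

variable [LieGroup (𝓡 n) ∞ G]

theorem contMDiffAt_extChartAt_symm_one :
    ContMDiffAt 𝓘(ℝ, EuclideanSpace ℝ (Fin n)) (𝓡 n) ∞ (extChartAt (𝓡 n) (1 : G)).symm
      (extChartAt (𝓡 n) (1 : G) 1) :=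
  (contMDiffOn_extChartAt_symm (1 : G)).contMDiffAt (extChartAt_target_mem_nhds (1 : G))

theorem contDiffAt_chartMul :
    ContDiffAt ℝ 2 (chartMul n G) (extChartAt (𝓡 n) (1 : G) 1, extChartAt (𝓡 n) (1 : G) 1) := by
  rw [← contMDiffAt_iff_contDiffAt]
  have h1 : ContMDiffAt 𝓘(ℝ, EuclideanSpace ℝ (Fin n) × EuclideanSpace ℝ (Fin n)) (𝓡 n) ∞
      (fun q => (extChartAt (𝓡 n) (1 : G)).symm q.1)
      (extChartAt (𝓡 n) (1 : G) 1, extChartAt (𝓡 n) (1 : G) 1) :=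
    ContMDiffAt.comp_of_eq contMDiffAt_extChartAt_symm_one contDiff_fst.contMDiff.contMDiffAt rfl
  have h2 : ContMDiffAt 𝓘(ℝ, EuclideanSpace ℝ (Fin n) × EuclideanSpace ℝ (Fin n)) (𝓡 n) ∞
      (fun q => (extChartAt (𝓡 n) (1 : G)).symm q.2)
      (extChartAt (𝓡 n) (1 : G) 1, extChartAt (𝓡 n) (1 : G) 1) :=
    ContMDiffAt.comp_of_eq contMDiffAt_extChartAt_symm_one contDiff_snd.contMDiff.contMDiffAt rfl
  have h3 : ContMDiffAt (𝓡 n) 𝓘(ℝ, EuclideanSpace ℝ (Fin n)) ∞ (extChartAt (𝓡 n) (1 : G)) 1 :=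
    contMDiffAt_extChartAt
  refine ContMDiffAt.of_le ?_ (m := 2) (n := ∞) ENat.LEInfty.out
  refine ContMDiffAt.comp_of_eq (y := 1) h3 (h1.mul h2) ?_
  simp

theorem contDiffAt_chartConj_uncurry :
    ContDiffAt ℝ 2 (fun q : EuclideanSpace ℝ (Fin n) × EuclideanSpace ℝ (Fin n) =>
        chartConj n ((extChartAt (𝓡 n) (1 : G)).symm q.1) q.2)
      (extChartAt (𝓡 n) (1 : G) 1, extChartAt (𝓡 n) (1 : G) 1) := by
  rw [← contMDiffAt_iff_contDiffAt]
  have h1 : ContMDiffAt 𝓘(ℝ, EuclideanSpace ℝ (Fin n) × EuclideanSpace ℝ (Fin n)) (𝓡 n) ∞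
      (fun q => (extChartAt (𝓡 n) (1 : G)).symm q.1)
      (extChartAt (𝓡 n) (1 : G) 1, extChartAt (𝓡 n) (1 : G) 1) :=
    ContMDiffAt.comp_of_eq contMDiffAt_extChartAt_symm_one contDiff_fst.contMDiff.contMDiffAt rfl
  have h2 : ContMDiffAt 𝓘(ℝ, EuclideanSpace ℝ (Fin n) × EuclideanSpace ℝ (Fin n)) (𝓡 n) ∞
      (fun q => (extChartAt (𝓡 n) (1 : G)).symm q.2)
      (extChartAt (𝓡 n) (1 : G) 1, extChartAt (𝓡 n) (1 : G) 1) :=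
    ContMDiffAt.comp_of_eq contMDiffAt_extChartAt_symm_one contDiff_snd.contMDiff.contMDiffAt rfl
  have h3 : ContMDiffAt (𝓡 n) 𝓘(ℝ, EuclideanSpace ℝ (Fin n)) ∞ (extChartAt (𝓡 n) (1 : G)) 1 :=
    contMDiffAt_extChartAt
  refine ContMDiffAt.of_le ?_ (m := 2) (n := ∞) ENat.LEInfty.out
  refine ContMDiffAt.comp_of_eq (y := 1) h3 ((h1.mul h2).mul h1.inv) ?_
  simp

theorem contDiffAt_chartConj (g : G) :
    ContDiffAt ℝ 1 (chartConj n g) (extChartAt (𝓡 n) (1 : G) 1) := by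
  rw [← contMDiffAt_iff_contDiffAt]
  have h3 : ContMDiffAt (𝓡 n) 𝓘(ℝ, EuclideanSpace ℝ (Fin n)) ∞ (extChartAt (𝓡 n) (1 : G)) 1 :=
    contMDiffAt_extChartAt
  refine ContMDiffAt.of_le ?_ (m := 1) (n := ∞) (by exact_mod_cast le_top)
  refine ContMDiffAt.comp_of_eq (y := 1) h3
    ((contMDiffAt_const.mul contMDiffAt_extChartAt_symm_one).mul contMDiffAt_const) ?_
  simp

theorem contMDiff_conj (g : G) : ContMDiff (𝓡 n) (𝓡 n) ∞ (fun x : G => g * x * g⁻¹) :=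
  (contMDiff_const.mul contMDiff_id).mul contMDiff_const

theorem mdifferentiableAt_conj (g x : G) :
    MDifferentiableAt (𝓡 n) (𝓡 n) (fun x : G => g * x * g⁻¹) x :=
  (contMDiff_conj g).mdifferentiableAt (by simp)

theorem mdifferentiableAt_mul_left (g x : G) :
    MDifferentiableAt (𝓡 n) (𝓡 n) (fun x : G => g * x) x :=
  (contMDiff_mul_left (I := 𝓡 n) (n := ∞)).mdifferentiableAt (by simp)

theorem mfderiv_conj_one (g : G) (v : EuclideanSpace ℝ (Fin n)) :
    (mfderiv (𝓡 n) (𝓡 n) (fun x : G => g * x * g⁻¹) 1 v : EuclideanSpace ℝ (Fin n))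
      = adjoint n g v := by
  have h1 : g * 1 * g⁻¹ = 1 := by simp
  have h2 : writtenInExtChartAt (𝓡 n) (𝓡 n) 1 (fun x : G => g * x * g⁻¹) = chartConj n g := by
    change extChartAt (𝓡 n) (g * 1 * g⁻¹) ∘ _ = _
    rw [h1]
    rfl
  have h3 : fderivWithin ℝ (writtenInExtChartAt (𝓡 n) (𝓡 n) 1 (fun x : G => g * x * g⁻¹))
      (Set.range (𝓡 n)) (extChartAt (𝓡 n) (1 : G) 1) = adjoint n g := by
    rw [h2, ModelWithCorners.range_eq_univ, fderivWithin_univ]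
    rfl
  exact congrArg (fun L : EuclideanSpace ℝ (Fin n) →L[ℝ] EuclideanSpace ℝ (Fin n) => L v)
    ((mdifferentiableAt_conj g 1).mfderiv.trans h3)

theorem adjoint_mul (g h : G) : adjoint n (g * h) = (adjoint n g).comp (adjoint n h) := by
  have hd (g : G) : DifferentiableAt ℝ (chartConj n g) (extChartAt (𝓡 n) (1 : G) 1) :=
    (contDiffAt_chartConj g).differentiableAt (by norm_num)
  have hev : chartConj n (g * h) =ᶠ[𝓝 (extChartAt (𝓡 n) (1 : G) 1)]
      chartConj n g ∘ chartConj n h := by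
    have hc : ContinuousAt (fun y => h * (extChartAt (𝓡 n) (1 : G)).symm y * h⁻¹)
        (extChartAt (𝓡 n) (1 : G) 1) :=
      ((contMDiffAt_const.mul contMDiffAt_extChartAt_symm_one).mul
        contMDiffAt_const : ContMDiffAt 𝓘(ℝ, EuclideanSpace ℝ (Fin n)) (𝓡 n) ∞ _ _).continuousAt
    have hmem : (extChartAt (𝓡 n) (1 : G)).source ∈
        𝓝 (h * (extChartAt (𝓡 n) (1 : G)).symm (extChartAt (𝓡 n) (1 : G) 1) * h⁻¹) := by
      simp only [extChartAt_symm_one, mul_one, mul_inv_cancel]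
      exact extChartAt_source_mem_nhds (1 : G)
    filter_upwards [hc.preimage_mem_nhds hmem] with y hy
    simp only [chartConj, Function.comp]
    rw [(extChartAt (𝓡 n) (1 : G)).left_inv hy]
    simp only [mul_inv_rev, mul_assoc]
  rw [adjoint, hev.fderiv_eq]
  have h1 : HasFDerivAt (chartConj n g) (adjoint n g)
      (chartConj n h (extChartAt (𝓡 n) (1 : G) 1)) := by
    rw [chartConj_one]
    exact (hd g).hasFDerivAt
  exact (h1.comp _ (hd h).hasFDerivAt).fderiv

theorem mfderiv_extChartAt_mulInvariantVectorField (v : GroupLieAlgebra (𝓡 n) G) (g : G)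
    (hg : g ∈ (extChartAt (𝓡 n) (1 : G)).source) :
    (mfderiv (𝓡 n) 𝓘(ℝ, EuclideanSpace ℝ (Fin n)) (extChartAt (𝓡 n) (1 : G)) g
        (mulInvariantVectorField v g) : EuclideanSpace ℝ (Fin n)) =
      fderiv ℝ (fun y => extChartAt (𝓡 n) (1 : G) (g * (extChartAt (𝓡 n) (1 : G)).symm y))
        (extChartAt (𝓡 n) (1 : G) 1) v := by
  have hφ : MDifferentiableAt (𝓡 n) 𝓘(ℝ, EuclideanSpace ℝ (Fin n)) (extChartAt (𝓡 n) (1 : G))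
      (g * 1) := by
    rw [mul_one]
    exact mdifferentiableAt_extChartAt (by rwa [extChartAt_source] at hg)
  have hcomp := mfderiv_comp (1 : G) hφ (mdifferentiableAt_mul_left g 1)
  have hd := hφ.comp (1 : G) (mdifferentiableAt_mul_left g 1)
  -- Typing the derivatives on the model space removes the dependence on the base point, so that `g
  -- * 1` can be replaced by `g`.
  let D : G → EuclideanSpace ℝ (Fin n) →L[ℝ] EuclideanSpace ℝ (Fin n) := fun h =>
    mfderiv (𝓡 n) 𝓘(ℝ, EuclideanSpace ℝ (Fin n)) (extChartAt (𝓡 n) (1 : G)) h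
  have h1 : D g = D (g * 1) := congrArg D (mul_one g).symm
  have h2 : D g (mulInvariantVectorField v g) =
      mfderiv (𝓡 n) 𝓘(ℝ, EuclideanSpace ℝ (Fin n))
        (extChartAt (𝓡 n) (1 : G) ∘ fun x => g * x) 1 v := by
    rw [hcomp]
    exact congrArg (fun L : EuclideanSpace ℝ (Fin n) →L[ℝ] EuclideanSpace ℝ (Fin n) =>
      L (mulInvariantVectorField v g)) h1
  have h3 : fderivWithin ℝ (writtenInExtChartAt (𝓡 n) 𝓘(ℝ, EuclideanSpace ℝ (Fin n)) 1
        (extChartAt (𝓡 n) (1 : G) ∘ fun x => g * x)) (Set.range (𝓡 n)) (extChartAt (𝓡 n) (1 : G) 1)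
      = fderiv ℝ (fun y => extChartAt (𝓡 n) (1 : G) (g * (extChartAt (𝓡 n) (1 : G)).symm y))
        (extChartAt (𝓡 n) (1 : G) 1) := by
    rw [ModelWithCorners.range_eq_univ, fderivWithin_univ]
    rfl
  exact h2.trans (congrArg (fun L : EuclideanSpace ℝ (Fin n) →L[ℝ] EuclideanSpace ℝ (Fin n) => L v)
    (hd.mfderiv.trans h3))

/-- The bracket at the identity is computed in the chart there. In it the left-invariant fields
become the partial derivatives of the local group law, and the chart has identity derivative at its
base point. -/
theorem bracket_eq_lieBracket_chartMul (v w : GroupLieAlgebra (𝓡 n) G) :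
    (⁅v, w⁆ : GroupLieAlgebra (𝓡 n) G) =
      VectorField.lieBracket ℝ
        (fun x => fderiv ℝ (fun y => chartMul n G (x, y)) (extChartAt (𝓡 n) (1 : G) 1) v)
        (fun x => fderiv ℝ (fun y => chartMul n G (x, y)) (extChartAt (𝓡 n) (1 : G) 1) w)
        (extChartAt (𝓡 n) (1 : G) 1) := by
  have hV (v : GroupLieAlgebra (𝓡 n) G) :
      VectorField.mpullbackWithin 𝓘(ℝ, EuclideanSpace ℝ (Fin n)) (𝓡 n)
        (extChartAt (𝓡 n) (1 : G)).symm (mulInvariantVectorField v) (Set.range (𝓡 n))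
      =ᶠ[𝓝 (extChartAt (𝓡 n) (1 : G) 1)]
        fun x => fderiv ℝ (fun y => chartMul n G (x, y)) (extChartAt (𝓡 n) (1 : G) 1) v := by
    filter_upwards [extChartAt_target_mem_nhds (I := 𝓡 n) (1 : G)] with x hx
    have hinv := ContinuousLinearMap.inverse_eq
      (mfderivWithin_extChartAt_symm_comp_mfderiv_extChartAt (I := 𝓡 n) hx)
      (mfderiv_extChartAt_comp_mfderivWithin_extChartAt_symm (I := 𝓡 n) hx)
    rw [VectorField.mpullbackWithin_apply, hinv]
    exact mfderiv_extChartAt_mulInvariantVectorField v _ ((extChartAt (𝓡 n) (1 : G)).map_target hx)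
  have hs : (extChartAt (𝓡 n) (1 : G)).symm ⁻¹' Set.univ ∩ Set.range (𝓡 n) = Set.univ := by
    simp
  have hinv : (mfderiv (𝓡 n) 𝓘(ℝ, EuclideanSpace ℝ (Fin n)) (extChartAt (𝓡 n) (1 : G)) 1).inverse
      = ContinuousLinearMap.id ℝ _ := by
    rw [mfderiv_extChartAt_self]
    exact ContinuousLinearMap.inverse_id
  rw [GroupLieAlgebra.bracket_def, VectorField.mlieBracket, VectorField.mlieBracketWithin_apply]
  refine (congrArg (fun L : EuclideanSpace ℝ (Fin n) →L[ℝ] EuclideanSpace ℝ (Fin n) => L _)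
    hinv).trans ?_
  rw [hs, ← ((hV v).lieBracket_vectorField (hV w)).eq_of_nhds]
  exact congrFun VectorField.lieBracketWithin_univ _

/-- The derivative of the adjoint action at the identity is the Lie bracket. -/
theorem fderiv_adjoint (v w : GroupLieAlgebra (𝓡 n) G) :
    HasFDerivAt (fun x => adjoint n ((extChartAt (𝓡 n) (1 : G)).symm x) w)
      (fderiv ℝ (fun x => adjoint n ((extChartAt (𝓡 n) (1 : G)).symm x) w)
        (extChartAt (𝓡 n) (1 : G) 1)) (extChartAt (𝓡 n) (1 : G) 1) ∧
    fderiv ℝ (fun x => adjoint n ((extChartAt (𝓡 n) (1 : G)).symm x) w)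
        (extChartAt (𝓡 n) (1 : G) 1) v = (⁅v, w⁆ : GroupLieAlgebra (𝓡 n) G) := by
  have hT := extChartAt_target_mem_nhds (I := 𝓡 n) (1 : G)
  have key := fderiv_local_adjoint (m := chartMul n G)
    (c := fun q => chartConj n ((extChartAt (𝓡 n) (1 : G)).symm q.1) q.2)
    contDiffAt_chartMul contDiffAt_chartConj_uncurry ?_ ?_ ?_ ?_ ?_ v w
  · rw [bracket_eq_lieBracket_chartMul]
    exact ⟨key.1.hasFDerivAt, key.2⟩
  · have h1 : ContinuousAt (fun q : EuclideanSpace ℝ (Fin n) × EuclideanSpace ℝ (Fin n) =>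
        (extChartAt (𝓡 n) (1 : G)).symm q.1) (extChartAt (𝓡 n) (1 : G) 1, extChartAt (𝓡 n) (1 : G) 1) :=
      ContinuousAt.comp (g := (extChartAt (𝓡 n) (1 : G)).symm)
        contMDiffAt_extChartAt_symm_one.continuousAt continuousAt_fst
    have h2 : ContinuousAt (fun q : EuclideanSpace ℝ (Fin n) × EuclideanSpace ℝ (Fin n) =>
        (extChartAt (𝓡 n) (1 : G)).symm q.2) (extChartAt (𝓡 n) (1 : G) 1, extChartAt (𝓡 n) (1 : G) 1) :=
      ContinuousAt.comp (g := (extChartAt (𝓡 n) (1 : G)).symm)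
        contMDiffAt_extChartAt_symm_one.continuousAt continuousAt_snd
    have : IsTopologicalGroup G := topologicalGroup_of_lieGroup (𝓡 n) ∞
    have h3 : ContinuousAt (fun q : EuclideanSpace ℝ (Fin n) × EuclideanSpace ℝ (Fin n) =>
        (extChartAt (𝓡 n) (1 : G)).symm q.1 * (extChartAt (𝓡 n) (1 : G)).symm q.2 *
          ((extChartAt (𝓡 n) (1 : G)).symm q.1)⁻¹)
        (extChartAt (𝓡 n) (1 : G) 1, extChartAt (𝓡 n) (1 : G) 1) := (h1.mul h2).mul h1.inv
    have hmem : (extChartAt (𝓡 n) (1 : G)).source ∈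
        𝓝 ((extChartAt (𝓡 n) (1 : G)).symm (extChartAt (𝓡 n) (1 : G) 1) *
          (extChartAt (𝓡 n) (1 : G)).symm (extChartAt (𝓡 n) (1 : G) 1) *
          ((extChartAt (𝓡 n) (1 : G)).symm (extChartAt (𝓡 n) (1 : G) 1))⁻¹) := by
      simp only [extChartAt_symm_one, mul_one, inv_one]
      exact extChartAt_source_mem_nhds (1 : G)
    filter_upwards [h3.preimage_mem_nhds hmem] with q hq
    simp only [chartMul, chartConj]
    rw [(extChartAt (𝓡 n) (1 : G)).left_inv hq]
    simp
  · filter_upwards [hT] with x hx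
    simp only [chartMul, extChartAt_symm_one, mul_one]
    exact (extChartAt (𝓡 n) (1 : G)).right_inv hx
  · filter_upwards [hT] with x hx
    simp only [chartMul, extChartAt_symm_one, one_mul]
    exact (extChartAt (𝓡 n) (1 : G)).right_inv hx
  · exact Eventually.of_forall fun x => chartConj_one _
  · filter_upwards [hT] with x hx
    simp only [chartConj, extChartAt_symm_one, one_mul, inv_one, mul_one]
    exact (extChartAt (𝓡 n) (1 : G)).right_inv hx

end Adjoint

/-! ### One-parameter groups and the adjoint action -/

section OneParameter

theorem isMIntegralCurve_comp {n : ℕ} {G : Type*} [TopologicalSpace G]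
    [ChartedSpace (EuclideanSpace ℝ (Fin n)) G] {γ : ℝ → G} {V V' : (x : G) → TangentSpace (𝓡 n) x}
    (hγ : IsMIntegralCurve (I := 𝓡 n) γ V) {f : G → G}
    (hf : ∀ x, MDifferentiableAt (𝓡 n) (𝓡 n) f x)
    (hV : ∀ x, (mfderiv (𝓡 n) (𝓡 n) f x (V x) : EuclideanSpace ℝ (Fin n)) = V' (f x)) :
    IsMIntegralCurve (I := 𝓡 n) (fun t => f (γ t)) V' := by
  intro t
  have h := (hf (γ t)).hasMFDerivAt.comp t (hγ t)
  refine h.congr_mfderiv ?_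
  refine ContinuousLinearMap.ext fun (a : ℝ) => ?_
  exact (map_smul (mfderiv (𝓡 n) (𝓡 n) f (γ t)) a (V (γ t))).trans
    (congrArg (fun v : EuclideanSpace ℝ (Fin n) => a • v) (hV (γ t)))

variable {n : ℕ} {G : Type*} [TopologicalSpace G] [ChartedSpace (EuclideanSpace ℝ (Fin n)) G]
  [Group G] [LieGroup (𝓡 n) ∞ G]

theorem mfderiv_mul_left_mulInvariantVectorField (g h : G) (X : GroupLieAlgebra (𝓡 n) G) :
    (mfderiv (𝓡 n) (𝓡 n) (fun x => g * x) h (mulInvariantVectorField X h)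
      : EuclideanSpace ℝ (Fin n)) = mulInvariantVectorField (I := 𝓡 n) X (g * h) := by
  let D : G → EuclideanSpace ℝ (Fin n) →L[ℝ] EuclideanSpace ℝ (Fin n) := fun k =>
    mfderiv (𝓡 n) (𝓡 n) (fun x => g * x) k
  have h1 : D h = D (h * 1) := congrArg D (mul_one h).symm
  have h2 := mfderiv_comp (1 : G) (mdifferentiableAt_mul_left (n := n) g (h * 1))
    (mdifferentiableAt_mul_left (n := n) h 1)
  have h3 : ((fun x => g * x) ∘ fun x => h * x) = fun x => g * h * x := by
    funext x
    simp [mul_assoc]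
  rw [h3] at h2
  exact (congrArg (fun L : EuclideanSpace ℝ (Fin n) →L[ℝ] EuclideanSpace ℝ (Fin n) =>
    L (mulInvariantVectorField X h)) h1).trans
    (congrArg (fun L : EuclideanSpace ℝ (Fin n) →L[ℝ] EuclideanSpace ℝ (Fin n) => L X) h2.symm)

theorem mfderiv_conj_mulInvariantVectorField (g h : G) (X : GroupLieAlgebra (𝓡 n) G) :
    (mfderiv (𝓡 n) (𝓡 n) (fun x => g * x * g⁻¹) h (mulInvariantVectorField X h)
      : EuclideanSpace ℝ (Fin n)) =
      mulInvariantVectorField (I := 𝓡 n) (adjoint n g X : GroupLieAlgebra (𝓡 n) G)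
        (g * h * g⁻¹) := by
  let D : G → EuclideanSpace ℝ (Fin n) →L[ℝ] EuclideanSpace ℝ (Fin n) := fun k =>
    mfderiv (𝓡 n) (𝓡 n) (fun x => g * x * g⁻¹) k
  let D' : G → EuclideanSpace ℝ (Fin n) →L[ℝ] EuclideanSpace ℝ (Fin n) := fun k =>
    mfderiv (𝓡 n) (𝓡 n) (fun x => g * h * g⁻¹ * x) k
  have h1 : D h = D (h * 1) := congrArg D (mul_one h).symm
  have h1' : D' (g * 1 * g⁻¹) = D' 1 := congrArg D' (by simp)
  have h2 := mfderiv_comp (1 : G) (mdifferentiableAt_conj (n := n) g (h * 1))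
    (mdifferentiableAt_mul_left (n := n) h 1)
  have h2' := mfderiv_comp (1 : G)
    (mdifferentiableAt_mul_left (n := n) (g * h * g⁻¹) (g * 1 * g⁻¹))
    (mdifferentiableAt_conj (n := n) g 1)
  have h3 : ((fun x => g * x * g⁻¹) ∘ fun x => h * x)
      = (fun x => g * h * g⁻¹ * x) ∘ fun x => g * x * g⁻¹ := by
    funext x
    simp [mul_assoc]
  rw [h3, h2'] at h2
  have h4 : D' (g * 1 * g⁻¹) (adjoint n g X) = D (h * 1) (mulInvariantVectorField X h) := by
    refine (congrArg (D' (g * 1 * g⁻¹)) (mfderiv_conj_one g X).symm).trans ?_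
    exact congrArg (fun L : EuclideanSpace ℝ (Fin n) →L[ℝ] EuclideanSpace ℝ (Fin n) => L X) h2
  rw [h1'] at h4
  rw [← h1] at h4
  exact h4.symm

theorem isMIntegralCurve_mul_left {γ : ℝ → G} {X : GroupLieAlgebra (𝓡 n) G}
    (hγ : IsMIntegralCurve (I := 𝓡 n) γ (mulInvariantVectorField X)) (g : G) :
    IsMIntegralCurve (I := 𝓡 n) (fun t => g * γ t) (mulInvariantVectorField X) :=
  isMIntegralCurve_comp hγ (mdifferentiableAt_mul_left g)
    fun x => mfderiv_mul_left_mulInvariantVectorField g x X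

theorem isMIntegralCurve_conj {γ : ℝ → G} {X : GroupLieAlgebra (𝓡 n) G}
    (hγ : IsMIntegralCurve (I := 𝓡 n) γ (mulInvariantVectorField X)) (g : G) :
    IsMIntegralCurve (I := 𝓡 n) (fun t => g * γ t * g⁻¹)
      (mulInvariantVectorField (adjoint n g X : GroupLieAlgebra (𝓡 n) G)) :=
  isMIntegralCurve_comp hγ (mdifferentiableAt_conj g)
    fun x => mfderiv_conj_mulInvariantVectorField g x X

theorem integralCurve_unique [T2Space G] {γ γ' : ℝ → G} {X : GroupLieAlgebra (𝓡 n) G}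
    (hγ : IsMIntegralCurve (I := 𝓡 n) γ (mulInvariantVectorField X))
    (hγ' : IsMIntegralCurve (I := 𝓡 n) γ' (mulInvariantVectorField X)) (h : γ 0 = γ' 0) :
    γ = γ' := by
  refine isMIntegralCurve_Ioo_eq_of_contMDiff_boundaryless (t₀ := 0) ?_ hγ hγ' h
  refine (contMDiff_mulInvariantVectorField X).of_le ?_
  rw [minSmoothness_of_isRCLikeNormedField]
  norm_num

/-- Left translation by `γ a` and the time shift by `a` give integral curves of the same field with
the same initial point. -/
theorem integralCurve_add [T2Space G] {γ : ℝ → G} {X : GroupLieAlgebra (𝓡 n) G}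
    (hγ : IsMIntegralCurve (I := 𝓡 n) γ (mulInvariantVectorField X)) (h0 : γ 0 = 1) (a b : ℝ) :
    γ (a + b) = γ a * γ b := by
  have h1 := isMIntegralCurve_mul_left hγ (γ a)
  have h2 := hγ.comp_add a
  have h3 := integralCurve_unique h2 h1 (by simp [h0])
  have := congrFun h3 b
  simpa [add_comm] using this

/-- The adjoint action along a one-parameter group solves the linear equation given by the bracket. -/
theorem hasDerivAt_adjoint [T2Space G] {γ : ℝ → G} {X : GroupLieAlgebra (𝓡 n) G}
    (hγ : IsMIntegralCurve (I := 𝓡 n) γ (mulInvariantVectorField X)) (h0 : γ 0 = 1)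
    (Y : GroupLieAlgebra (𝓡 n) G) (t : ℝ) :
    HasDerivAt (fun t => adjoint n (γ t) Y)
      (adjoint n (γ t) (⁅X, Y⁆ : GroupLieAlgebra (𝓡 n) G)) t := by
  have hφγ : HasDerivAt (fun t => extChartAt (𝓡 n) (1 : G) (γ t)) X 0 := by
    have hV : (mulInvariantVectorField (I := 𝓡 n) X (γ 0) : EuclideanSpace ℝ (Fin n)) = X := by
      rw [h0]
      have h2 : (fun x : G => 1 * x) = id := by
        funext x
        simp
      have h1 : mfderiv (𝓡 n) (𝓡 n) (fun x : G => 1 * x) 1 = ContinuousLinearMap.id ℝ _ := by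
        rw [h2]
        exact mfderiv_id
      exact congrArg (fun L : EuclideanSpace ℝ (Fin n) →L[ℝ] EuclideanSpace ℝ (Fin n) => L X) h1
    have h1 := (hγ 0).2
    have h2 : HasFDerivAt (fun t => extChartAt (𝓡 n) (γ 0) (γ t))
        ((1 : ℝ →L[ℝ] ℝ).smulRight
          (mulInvariantVectorField (I := 𝓡 n) X (γ 0) : EuclideanSpace ℝ (Fin n))) 0 := by
      rw [← hasFDerivWithinAt_univ]
      convert! h1 using 1
      simp
    have h3 := h2.hasDerivAt.congr_deriv ((one_smul ℝ _).trans hV)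
    rwa [h0] at h3
  have hc : Tendsto γ (𝓝 0) (𝓝 1) := by
    have := hγ.continuous.tendsto 0
    rwa [h0] at this
  have hzero : HasDerivAt (fun t => adjoint n (γ t) Y) (⁅X, Y⁆ : GroupLieAlgebra (𝓡 n) G) 0 := by
    obtain ⟨h1, h2⟩ := fderiv_adjoint (n := n) (G := G) X Y
    have h3 : HasDerivAt (fun t => adjoint n ((extChartAt (𝓡 n) (1 : G)).symm
        (extChartAt (𝓡 n) (1 : G) (γ t))) Y) (⁅X, Y⁆ : GroupLieAlgebra (𝓡 n) G) 0 :=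
      (HasFDerivAt.comp_hasDerivAt_of_eq (f := fun t => extChartAt (𝓡 n) (1 : G) (γ t)) 0 h1 hφγ
        (by rw [h0])).congr_deriv h2
    refine h3.congr_of_eventuallyEq ?_
    filter_upwards [hc.eventually (extChartAt_source_mem_nhds (I := 𝓡 n) (1 : G))] with t ht
    rw [(extChartAt (𝓡 n) (1 : G)).left_inv ht]
  -- The homomorphism property moves the derivative from time `0` to time `t`.
  have heq : (fun u => adjoint n (γ u) Y) = fun u => adjoint n (γ t) (adjoint n (γ (u - t)) Y) := by
    funext u
    have h1 : adjoint n (γ u) = (adjoint n (γ t)).comp (adjoint n (γ (u - t))) := by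
      rw [← adjoint_mul, ← integralCurve_add hγ h0, add_sub_cancel]
    exact congrArg (fun L : EuclideanSpace ℝ (Fin n) →L[ℝ] EuclideanSpace ℝ (Fin n) => L Y) h1
  rw [heq]
  have h4 : HasDerivAt (fun u => adjoint n (γ (u - t)) Y) (⁅X, Y⁆ : GroupLieAlgebra (𝓡 n) G) t := by
    rw [← sub_self t] at hzero
    exact hzero.comp_sub_const t t
  exact (adjoint n (γ t)).hasFDerivAt.comp_hasDerivAt t h4

theorem adjoint_eq_self_of_bracket_eq_zero [T2Space G] {γ : ℝ → G} {X : GroupLieAlgebra (𝓡 n) G}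
    (hγ : IsMIntegralCurve (I := 𝓡 n) γ (mulInvariantVectorField X)) (h0 : γ 0 = 1)
    {Y : GroupLieAlgebra (𝓡 n) G} (hXY : ⁅X, Y⁆ = 0) (t : ℝ) : adjoint n (γ t) Y = Y := by
  have h : ∀ t, HasDerivAt (fun t => adjoint n (γ t) Y) 0 t := by
    intro t
    have h1 := hasDerivAt_adjoint hγ h0 Y t
    rw [hXY] at h1
    convert! h1 using 1
    exact (map_zero (adjoint n (γ t))).symm
  have h2 := is_const_of_deriv_eq_zero (fun t => (h t).differentiableAt)
    (fun t => (h t).deriv) t 0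
  rw [h2, h0, adjoint_one]
  rfl

/-- The derivative is `Ad (γ t) ⁅X, Y⁆`, which is constant because `X` commutes with `⁅X, Y⁆`. -/
theorem adjoint_eq_add_smul [T2Space G] {γ : ℝ → G} {X : GroupLieAlgebra (𝓡 n) G}
    (hγ : IsMIntegralCurve (I := 𝓡 n) γ (mulInvariantVectorField X)) (h0 : γ 0 = 1)
    {Y : GroupLieAlgebra (𝓡 n) G} (hXY : ⁅X, ⁅X, Y⁆⁆ = 0) (t : ℝ) :
    adjoint n (γ t) Y = Y + t • (⁅X, Y⁆ : GroupLieAlgebra (𝓡 n) G) := by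
  let E := EuclideanSpace ℝ (Fin n)
  let Z : E := (⁅X, Y⁆ : GroupLieAlgebra (𝓡 n) G)
  have h : ∀ t, HasDerivAt (fun t => adjoint n (γ t) Y - t • Z) 0 t := by
    intro t
    have h1 := hasDerivAt_adjoint hγ h0 Y t
    rw [adjoint_eq_self_of_bracket_eq_zero hγ h0 hXY] at h1
    have h2 : HasDerivAt (fun t : ℝ => t • Z) ((1 : ℝ) • Z) t := (hasDerivAt_id t).smul_const Z
    have h3 := h1.sub h2
    rw [one_smul] at h3
    convert! h3 using 1
    exact (sub_self Z).symm
  have h2 := is_const_of_deriv_eq_zero (fun t => (h t).differentiableAt)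
    (fun t => (h t).deriv) t 0
  simp only [h0, adjoint_one, zero_smul, sub_zero] at h2
  exact sub_eq_iff_eq_add.1 h2

/-- One-parameter groups with commuting generators commute. -/
theorem commute_of_bracket_eq_zero [T2Space G] {γ δ : ℝ → G} {X Y : GroupLieAlgebra (𝓡 n) G}
    (hγ : IsMIntegralCurve (I := 𝓡 n) γ (mulInvariantVectorField X)) (hγ0 : γ 0 = 1)
    (hδ : IsMIntegralCurve (I := 𝓡 n) δ (mulInvariantVectorField Y)) (hδ0 : δ 0 = 1)
    (hXY : ⁅X, Y⁆ = 0) (a b : ℝ) : Commute (γ a) (δ b) := by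
  -- Conjugation by `γ a` fixes the generator `Y`, hence also its integral curve through the
  -- identity.
  have h1 := isMIntegralCurve_conj hδ (γ a)
  rw [adjoint_eq_self_of_bracket_eq_zero hγ hγ0 hXY] at h1
  have h2 := integralCurve_unique h1 hδ (by simp [hδ0])
  have h3 : γ a * δ b * (γ a)⁻¹ = δ b := congrFun h2 b
  exact mul_inv_eq_iff_eq_mul.1 h3

theorem continuousAt_adjoint (Y : GroupLieAlgebra (𝓡 n) G) :
    ContinuousAt (fun g : G => adjoint n g Y) 1 := by
  obtain ⟨h1, -⟩ := fderiv_adjoint (n := n) (G := G) 0 Y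
  have h2 : ContinuousAt (fun g : G => adjoint n ((extChartAt (𝓡 n) (1 : G)).symm
      (extChartAt (𝓡 n) (1 : G) g)) Y) 1 :=
    ContinuousAt.comp (f := extChartAt (𝓡 n) (1 : G)) h1.continuousAt
      (continuousAt_extChartAt (1 : G))
  refine h2.congr ?_
  filter_upwards [extChartAt_source_mem_nhds (I := 𝓡 n) (1 : G)] with g hg
  rw [(extChartAt (𝓡 n) (1 : G)).left_inv hg]

end OneParameter

/-! ### Times that preserve the measure: all of `ℝ`, or countably many -/

section Alternative

/-- The times at which a flow preserves the integrals of continuous functions. -/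
def invariantTimes {M : Type*} [TopologicalSpace M] [MeasurableSpace M]
    (φ : Flow ℝ M) (μ : Measure M) : AddSubgroup ℝ where
  carrier := {t | ∀ f : C(M, ℝ), ∫ x, f (φ t x) ∂μ = ∫ x, f x ∂μ}
  zero_mem' := by
    intro f
    simp
  add_mem' := by
    intro a b ha hb f
    have h := ha (f.comp ⟨φ b, φ.continuous_toFun b⟩)
    simp only [ContinuousMap.comp_apply, ContinuousMap.coe_mk, ← φ.map_add] at h
    rw [add_comm, h]
    exact hb f
  neg_mem' := by
    intro a ha f
    have h := ha (f.comp ⟨φ (-a), φ.continuous_toFun (-a)⟩)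
    simp only [ContinuousMap.comp_apply, ContinuousMap.coe_mk, ← φ.map_add, neg_add_cancel,
      φ.map_zero_apply] at h
    exact h.symm

theorem mem_invariantTimes_of_map_eq {M : Type*} [TopologicalSpace M]
    [MeasurableSpace M] [BorelSpace M] {φ : Flow ℝ M} {μ : Measure M} {t : ℝ}
    (h : μ.map (φ t) = μ) : t ∈ invariantTimes φ μ := by
  intro f
  conv_rhs => rw [← h]
  rw [integral_map (φ.continuous_toFun t).aemeasurable f.continuous.aestronglyMeasurable]

variable {M : Type*} [TopologicalSpace M] [CompactSpace M] [T2Space M] [SecondCountableTopology M]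
  [MeasurableSpace M] [BorelSpace M]

theorem isClosed_invariantTimes (φ : Flow ℝ M) (μ : Measure M) [IsFiniteMeasure μ] :
    IsClosed (invariantTimes φ μ : Set ℝ) := by
  have : (invariantTimes φ μ : Set ℝ) =
      ⋂ f : C(M, ℝ), {t | ∫ x, f (φ t x) ∂μ = ∫ x, f x ∂μ} := by
    ext t
    simp [invariantTimes]
  rw [this]
  refine isClosed_iInter fun f => isClosed_eq ?_ continuous_const
  have hc : Continuous (Function.uncurry fun (t : ℝ) (x : M) => f (φ t x)) :=
    f.continuous.comp (φ.continuous continuous_fst continuous_snd)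
  have := continuous_parametric_integral_of_continuous (μ := μ) hc isCompact_univ
  simpa using this

theorem map_eq_of_mem_invariantTimes {φ : Flow ℝ M} {μ : Measure M} [IsFiniteMeasure μ] {t : ℝ}
    (h : t ∈ invariantTimes φ μ) : μ.map (φ t) = μ := by
  let _ := TopologicalSpace.metrizableSpaceMetric M
  refine ext_of_forall_integral_eq_of_IsFiniteMeasure fun f => ?_
  rw [integral_map (φ.continuous_toFun t).aemeasurable f.continuous.aestronglyMeasurable]
  exact h f.toContinuousMap

/-- If a flow commutes with an ergodic transformation, then either it preserves the measure or some
set of full measure meets every orbit in a countable set of times. -/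
theorem forall_map_eq_or_exists_countable {μ : Measure M} [IsProbabilityMeasure μ] {T : M → M}
    (hT : Ergodic T μ) (φ : Flow ℝ M) (hcomm : ∀ t, Function.Commute (φ t) T) :
    (∀ t, μ.map (φ t) = μ) ∨
      ∃ N : Set M, MeasurableSet N ∧ μ N = 0 ∧ ∀ x ∉ N, {t | φ t x ∉ N}.Countable := by
  obtain ⟨n, hn⟩ := exists_ae_mem_genericPoints hT
  rcases AddSubgroup.dense_or_cyclic (invariantTimes φ μ) with hd | ⟨a, ha⟩
  · left
    intro t
    have h1 : (invariantTimes φ μ : Set ℝ) = Set.univ := by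
      rw [← (isClosed_invariantTimes φ μ).closure_eq]
      exact hd.closure_eq
    have h2 : t ∈ (invariantTimes φ μ : Set ℝ) := h1 ▸ Set.mem_univ t
    exact map_eq_of_mem_invariantTimes h2
  · right
    -- A measurable null hull of the non-generic points, so that measurability of the generic set
    -- itself is not needed.
    refine ⟨toMeasurable μ (genericPoints μ T n)ᶜ, measurableSet_toMeasurable _ _, ?_, ?_⟩
    · rw [measure_toMeasurable]
      exact hn
    · have hsub {x : M} (hx : x ∉ toMeasurable μ (genericPoints μ T n)ᶜ) :
          x ∈ genericPoints μ T n := by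
        by_contra h
        exact hx (subset_toMeasurable _ _ h)
      intro x hx
      have hc : (invariantTimes φ μ : Set ℝ).Countable := by
        rw [ha, ← AddSubgroup.zmultiples_eq_closure]
        exact Set.countable_range _
      refine hc.mono fun t ht => ?_
      exact mem_invariantTimes_of_map_eq
        (map_eq_of_mem_genericPoints (φ.continuous_toFun t) (hcomm t) (hsub hx) (hsub ht))

end Alternative

/-! ### Conditional measures and countable returns -/

section Conditional

variable {M : Type*} [MeasurableSpace M] [StandardBorelSpace M]

/-- The conditional measures integrate to `μ`, so `μ N = 0` is the integral of their masses on `N`.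
-/
theorem ae_condExpKernel_eq_zero {M : Type*} {m : MeasurableSpace M} [mM : MeasurableSpace M]
    [StandardBorelSpace M] {μ : Measure M} [IsFiniteMeasure μ] (hm : m ≤ mM) {N : Set M}
    (hN : MeasurableSet N) (h0 : μ N = 0) :
    ∀ᵐ x ∂μ, condExpKernel μ m x N = 0 := by
  have h1 := condExpKernel_comp_trim (μ := μ) hm
  have h2 : (condExpKernel μ m ∘ₘ μ.trim hm) N = 0 := by rw [h1, h0]
  rw [Measure.bind_apply hN (Kernel.aemeasurable _)] at h2
  have h3 := (lintegral_eq_zero_iff (Kernel.measurable_coe _ hN)).1 h2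
  exact ae_of_ae_trim hm h3

/-- If the leafwise measures have no atoms and there is a subordinate partition, then no set of full
measure meets the orbits of all its points in countable sets. -/
theorem not_exists_null_of_isLeafwiseFamily [Nonempty M] {G : Type*} [Group G] [TopologicalSpace G]
    [MeasurableSpace G] [MulAction G M] {H : Subgroup G}
    (hmeas : ∀ x : M, Measurable fun h : H => h • x)
    {μ : Measure M} [IsProbabilityMeasure μ] {ν : M → Measure H} (hν : IsLeafwiseFamily H μ ν)
    (hna : ∀ᵐ x ∂μ, ∀ h, ν x {h} = 0) {η : MeasurablePartition M} (hη : IsSubordinate H μ η)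
    {N : Set M} (hN : MeasurableSet N) (hN0 : μ N = 0)
    (hc : ∀ x ∉ N, {h : H | h • x ∉ N}.Countable) : False := by
  obtain ⟨c, -, -, hcond⟩ := hν η hη
  have h1 := ae_condExpKernel_eq_zero η.sigma_le hN hN0
  have h2 : ∀ᵐ x ∂μ, x ∉ N := measure_eq_zero_iff_ae_notMem.1 hN0
  -- At this point the conditional probability gives mass zero to `N`, a null set, and to `Nᶜ`,
  -- which the orbit meets in a countable set.
  obtain ⟨x, hx, hxa, hxk, hxN⟩ := (hcond.and (hna.and (h1.and h2))).exists
  have : NullSingletonClass (ν x) := ⟨hxa⟩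
  have h3 : ((ν x).map fun h : H => h • x) Nᶜ = 0 := by
    rw [Measure.map_apply (hmeas x) hN.compl]
    exact (hc x hxN).measure_zero _
  have h4 : condExpKernel μ η.sigma x Nᶜ = 0 := by
    rw [hx, Measure.smul_apply]
    have h5 : (((ν x).map fun h : H => h • x).restrict (η.cell x)) Nᶜ = 0 :=
      le_antisymm ((Measure.restrict_apply_le _ _).trans h3.le) zero_le
    rw [h5, smul_zero]
  have h5 : condExpKernel μ η.sigma x Set.univ = 1 := measure_univ
  have h6 : condExpKernel μ η.sigma x Set.univ ≤ 0 := by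
    rw [← Set.union_compl_self N]
    refine (measure_union_le _ _).trans ?_
    rw [hxk, h4, add_zero]
  rw [h5] at h6
  exact absurd h6 (by simp)

end Conditional

/-! ### Root groups as one-parameter groups -/

section RootGroups

variable {n : ℕ} {G : Type*} [TopologicalSpace G] [ChartedSpace (EuclideanSpace ℝ (Fin n)) G]
  [Group G]

theorem integralCurve_smul {γ : ℝ → G} {X : GroupLieAlgebra (𝓡 n) G}
    (hγ : IsMIntegralCurve (I := 𝓡 n) γ (mulInvariantVectorField X)) (a : ℝ) :
    IsMIntegralCurve (I := 𝓡 n) (fun t => γ (t * a))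
      (mulInvariantVectorField (a • X : GroupLieAlgebra (𝓡 n) G)) := by
  rw [mulInvariantVectorField_smul]
  exact hγ.comp_mul a

variable [LieGroup (𝓡 n) ∞ G]

instance : FiniteDimensional ℝ (GroupLieAlgebra (𝓡 n) G) :=
  inferInstanceAs (FiniteDimensional ℝ (EuclideanSpace ℝ (Fin n)))

/-- The group generated by the exponentials of a line is trivial or a one-parameter group. -/
theorem expSubgroup_eq_bot_or_exists [T2Space G] {V : Submodule ℝ (GroupLieAlgebra (𝓡 n) G)}
    (hV : Module.finrank ℝ V ≤ 1) :
    expSubgroup V = ⊥ ∨ ∃ (γ : ℝ → G) (X : GroupLieAlgebra (𝓡 n) G), X ∈ V ∧ X ≠ 0 ∧ γ 0 = 1 ∧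
      IsMIntegralCurve (I := 𝓡 n) γ (mulInvariantVectorField X) ∧
      ∀ g, g ∈ expSubgroup V ↔ ∃ t, γ t = g := by
  -- Completeness of the left-invariant fields is not needed: if no nonzero vector of `V` has an
  -- exponential, only the identity generates the group.
  by_cases h : ∃ X ∈ V, X ≠ 0 ∧ ∃ g, IsExp X g
  · right
    obtain ⟨X, hX, hX0, g, γ, hγ0, hγ, -⟩ := h
    refine ⟨γ, X, hX, hX0, hγ0, hγ, fun g => ⟨fun hg => ?_, ?_⟩⟩
    · have hadd := integralCurve_add hγ hγ0
      induction hg using Subgroup.closure_induction with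
      | mem g hg =>
        obtain ⟨Y, hY, δ, hδ0, hδ, rfl⟩ := hg
        obtain ⟨c, hc⟩ : ∃ c : ℝ, c • X = Y := by
          have h1 := finrank_le_one_iff.1 hV
          obtain ⟨v, hv⟩ := h1
          obtain ⟨a, ha⟩ := hv ⟨X, hX⟩
          obtain ⟨b, hb⟩ := hv ⟨Y, hY⟩
          have ha' : a • (v : GroupLieAlgebra (𝓡 n) G) = X := congrArg Subtype.val ha
          have hb' : b • (v : GroupLieAlgebra (𝓡 n) G) = Y := congrArg Subtype.val hb
          have ha0 : a ≠ 0 := by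
            rintro rfl
            exact hX0 (by rw [← ha', zero_smul])
          refine ⟨b * a⁻¹, ?_⟩
          rw [← ha', ← hb', smul_smul, mul_assoc, inv_mul_cancel₀ ha0, mul_one]
        subst hc
        have h1 := integralCurve_unique (integralCurve_smul hγ c) hδ (by simp [hγ0, hδ0])
        exact ⟨c, by rw [← h1]; simp⟩
      | one => exact ⟨0, hγ0⟩
      | mul x y _ _ hx hy =>
        obtain ⟨a, rfl⟩ := hx
        obtain ⟨b, rfl⟩ := hy
        exact ⟨a + b, hadd a b⟩
      | inv x _ hx =>
        obtain ⟨a, rfl⟩ := hx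
        refine ⟨-a, ?_⟩
        rw [eq_inv_iff_mul_eq_one, ← hadd, neg_add_cancel, hγ0]
    · rintro ⟨t, rfl⟩
      refine Subgroup.subset_closure ⟨t • X, V.smul_mem t hX, fun u => γ (u * t), ?_,
        integralCurve_smul hγ t, ?_⟩ <;> simp [hγ0]
  · left
    rw [eq_bot_iff, expSubgroup, Subgroup.closure_le]
    rintro g ⟨X, hX, γ, hγ0, hγ, rfl⟩
    have hX0 : X = 0 := by
      by_contra hX0
      exact h ⟨X, hX, hX0, γ 1, γ, hγ0, hγ, rfl⟩
    subst hX0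
    have hc : IsMIntegralCurve (I := 𝓡 n) (fun _ : ℝ => (1 : G))
        (mulInvariantVectorField (0 : GroupLieAlgebra (𝓡 n) G)) :=
      isMIntegralCurve_const (map_zero _)
    have := integralCurve_unique hγ hc hγ0
    exact congrFun this 1

variable [LieAlgebra.IsSimple ℝ (GroupLieAlgebra (𝓡 n) G)]
  {𝔞 : LieSubalgebra ℝ (GroupLieAlgebra (𝓡 n) G)} [𝔞.IsCartanSubalgebra]
  [LieModule.IsTriangularizable ℝ 𝔞 (GroupLieAlgebra (𝓡 n) G)]

theorem finrank_rootSpace_le_one {β : Module.Dual ℝ 𝔞} (hβ : β ≠ 0) :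
    Module.finrank ℝ (LieAlgebra.rootSpace 𝔞 (⇑β)).toSubmodule ≤ 1 := by
  by_cases h : LieAlgebra.rootSpace 𝔞 (⇑β) = ⊥
  · rw [h]
    simp
  · let W : LieModule.Weight ℝ 𝔞 (GroupLieAlgebra (𝓡 n) G) := ⟨⇑β, h⟩
    have hW : W.IsNonZero := by
      intro h0
      apply hβ
      ext x
      exact congrFun h0 x
    exact (LieAlgebra.IsKilling.finrank_rootSpace_eq_one W hW).le

/-- A root space is by definition a generalized weight space. Here it is a true eigenspace, because
the Killing form is nondegenerate and `𝔞` acts triangularizably. -/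
theorem bracket_of_mem_rootSpace {β : Module.Dual ℝ 𝔞} {X : GroupLieAlgebra (𝓡 n) G}
    (hX : X ∈ LieAlgebra.rootSpace 𝔞 (⇑β)) (h : 𝔞) :
    ⁅(h : GroupLieAlgebra (𝓡 n) G), X⁆ = β h • X :=
  LieAlgebra.IsKilling.lie_eq_smul_of_mem_rootSpace hX h

/-- Elements of the kernel of a root commute with the one-parameter groups of the opposite root. -/
theorem commute_of_mem_rootKernel [T2Space G] {α : Module.Dual ℝ 𝔞} {s : G}
    (hs : s ∈ rootKernel 𝔞 α) {γ : ℝ → G} {X : GroupLieAlgebra (𝓡 n) G}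
    (hX : X ∈ LieAlgebra.rootSpace 𝔞 (⇑(-α))) (hγ0 : γ 0 = 1)
    (hγ : IsMIntegralCurve (I := 𝓡 n) γ (mulInvariantVectorField X)) (t : ℝ) :
    Commute s (γ t) := by
  induction hs using Subgroup.closure_induction with
  | mem g hg =>
    obtain ⟨Y, hY, δ, hδ0, hδ, rfl⟩ := hg
    obtain ⟨h, hh, rfl⟩ := hY
    refine commute_of_bracket_eq_zero hδ hδ0 hγ hγ0 ?_ 1 t
    have h1 := bracket_of_mem_rootSpace hX h
    have h2 : α h = 0 := hh
    rw [LinearMap.neg_apply, h2, neg_zero, zero_smul] at h1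
    exact h1
  | one => exact Commute.one_left _
  | mul x y _ _ hx hy => exact hx.mul_left hy
  | inv x _ hx => exact hx.inv_left

/-- A one-parameter group of a root is embedded: its parameter is controlled by the adjoint action. -/
theorem exists_adjoint_eq_add_smul [T2Space G] {β : Module.Dual ℝ 𝔞} (hβ : β ≠ 0) {γ : ℝ → G}
    {X : GroupLieAlgebra (𝓡 n) G} (hX : X ∈ LieAlgebra.rootSpace 𝔞 (⇑β)) (hX0 : X ≠ 0)
    (hγ0 : γ 0 = 1) (hγ : IsMIntegralCurve (I := 𝓡 n) γ (mulInvariantVectorField X)) :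
    ∃ Y Z : EuclideanSpace ℝ (Fin n), Z ≠ 0 ∧ ∀ t, adjoint n (γ t) Y = Y + t • Z := by
  obtain ⟨h, hh⟩ : ∃ h, β h ≠ 0 := by
    by_contra! h0
    exact hβ (LinearMap.ext h0)
  have h1 := bracket_of_mem_rootSpace hX h
  have h2 : ⁅X, (h : GroupLieAlgebra (𝓡 n) G)⁆ = -(β h • X) := by
    rw [← lie_skew, h1]
  let Z : GroupLieAlgebra (𝓡 n) G := ⁅X, (h : GroupLieAlgebra (𝓡 n) G)⁆
  -- The vector moved is an `h ∈ 𝔞` with `β h ≠ 0`: then `⁅X, h⁆ = -β(h) X` is nonzero and commutes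
  -- with `X`, so `Ad (γ t)` moves `h` linearly in `t`.
  refine ⟨(h : GroupLieAlgebra (𝓡 n) G), Z, ?_, adjoint_eq_add_smul hγ hγ0 ?_⟩
  · intro h3
    have h4 : ⁅X, (h : GroupLieAlgebra (𝓡 n) G)⁆ = 0 := h3
    rw [h2, neg_eq_zero, smul_eq_zero] at h4
    exact h4.elim hh hX0
  · rw [h2, lie_neg, lie_smul, lie_self, smul_zero, neg_zero]

end RootGroups

/-! ### Rigidity for one-parameter groups and the proposition -/

section Conclusion

/-- The flow of a one-parameter group. -/
def oneParameterFlow {G M : Type*} [TopologicalSpace G] [Group G] [TopologicalSpace M]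
    [MulAction G M] (hsmul : Continuous fun p : G × M => p.1 • p.2) {γ : ℝ → G}
    (hγ : Continuous γ) (hγ0 : γ 0 = 1) (hadd : ∀ a b, γ (a + b) = γ a * γ b) : Flow ℝ M where
  toFun t x := γ t • x
  cont' := hsmul.comp ((hγ.comp continuous_fst).prodMk continuous_snd)
  map_add' a b x := by rw [hadd, mul_smul]
  map_zero' x := by rw [hγ0, one_smul]

/-- Rigidity for a one-parameter subgroup `H`, parametrized by `γ`, that is centralized by an element
acting ergodically. -/
theorem smulInvariantMeasure_of_oneParameter {G M : Type*} [TopologicalSpace G] [Group G]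
    [MeasurableSpace G] [BorelSpace G] [TopologicalSpace M]
    [CompactSpace M] [T2Space M] [SecondCountableTopology M] [MeasurableSpace M] [BorelSpace M]
    [MulAction G M] (hsmul : Continuous fun p : G × M => p.1 • p.2)
    {s : G} {μ : Measure M} [IsProbabilityMeasure μ] (herg : Ergodic (fun x : M => s • x) μ)
    {H : Subgroup G} {γ : ℝ → G} (hγ : Continuous γ) (hγ0 : γ 0 = 1)
    (hadd : ∀ a b, γ (a + b) = γ a * γ b) (hH : ∀ g, g ∈ H ↔ ∃ t, γ t = g)
    (hcomm : ∀ t, Commute s (γ t))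
    (hemb : ∀ ε > 0, ∃ U ∈ 𝓝 (1 : G), ∀ t, γ t ∈ U → |t| < ε)
    (hfree : ∀ x : M, ∃ t, γ t • x ≠ x)
    {ν : M → Measure H} (hν : IsLeafwiseFamily H μ ν) (hna : ∀ᵐ x ∂μ, ∀ h, ν x {h} = 0) :
    SMulInvariantMeasure H M μ := by
  let φ : Flow ℝ M := oneParameterFlow hsmul hγ hγ0 hadd
  have hφ (t : ℝ) (x : M) : φ t x = γ t • x := rfl
  have hne : Nonempty M := μ.nonempty_of_neZero
  rcases forall_map_eq_or_exists_countable herg φ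
    (fun t x => by simp only [hφ, smul_smul, (hcomm t).eq]) with h | ⟨N, hN, hN0, hc⟩
  · refine ⟨fun ⟨g, hg⟩ A hA => ?_⟩
    obtain ⟨t, rfl⟩ := (hH g).1 hg
    have h1 := congrArg (fun m => m A) (h t)
    simp only [Measure.map_apply (φ.continuous_toFun t).measurable hA] at h1
    exact h1
  · exfalso
    obtain ⟨η, hη⟩ := exists_partition_subordinate_flow φ hfree μ
    have hηs : IsSubordinate H μ η := by
      filter_upwards [hη] with x hx
      refine ⟨hx.1.trans ?_, ?_⟩
      · rintro _ ⟨t, rfl⟩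
        exact ⟨⟨γ t, (hH _).2 ⟨t, rfl⟩⟩, rfl⟩
      -- The partition contains the orbit for small times, while subordination refers to the
      -- topology that `H` inherits from `G`; `hemb` says that elements of `H` near `1` come only
      -- from small times.
      · obtain ⟨ε, hε, hεx⟩ := Metric.eventually_nhds_iff.1 hx.2
        obtain ⟨U, hU, hUε⟩ := hemb ε hε
        have hU' : (Subtype.val : H → G) ⁻¹' U ∈ 𝓝 (1 : H) :=
          continuous_subtype_val.continuousAt.preimage_mem_nhds hU
        filter_upwards [hU'] with g hgU
        obtain ⟨t, ht⟩ := (hH g.1).1 g.2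
        have h1 : φ t x ∈ η.cell x := by
          refine hεx ?_
          rw [Real.dist_eq, sub_zero]
          exact hUε t (by rw [ht]; exact hgU)
        rw [hφ, ht] at h1
        exact h1
    refine not_exists_null_of_isLeafwiseFamily (fun x => ?_) hν hna hηs hN hN0 fun x hx => ?_
    · exact (hsmul.comp (continuous_subtype_val.prodMk continuous_const) :
        Continuous fun h : H => (h : G) • x).measurable
    · refine ((hc x hx).image fun t => (⟨γ t, (hH _).2 ⟨t, rfl⟩⟩ : H)).mono ?_
      rintro ⟨g, hg⟩ hgx
      obtain ⟨t, rfl⟩ := (hH g).1 hg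
      exact ⟨t, hgx, rfl⟩

end Conclusion

end EntropicRigidity

open EntropicRigidity in
theorem proposition4p4
    {n : ℕ} {G : Type*} [TopologicalSpace G] [ChartedSpace (EuclideanSpace ℝ (Fin n)) G]
    [Group G] [LieGroup (𝓡 n) ∞ G]
    [IsTopologicalGroup G] [T2Space G] [SecondCountableTopology G] [NoncompactSpace G]
    [MeasurableSpace G] [BorelSpace G]
    [LieAlgebra.IsSimple ℝ (GroupLieAlgebra (𝓡 n) G)] [Finite (Subgroup.center G)]
    (𝔞 : LieSubalgebra ℝ (GroupLieAlgebra (𝓡 n) G)) [𝔞.IsCartanSubalgebra]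
    [LieModule.IsTriangularizable ℝ 𝔞 (GroupLieAlgebra (𝓡 n) G)]
    {m : ℕ} {M : Type*} [TopologicalSpace M] [ChartedSpace (EuclideanSpace ℝ (Fin m)) M]
    [IsManifold (𝓡 m) 1 M]
    [CompactSpace M] [T2Space M] [SecondCountableTopology M] [MeasurableSpace M] [BorelSpace M]
    [MulAction G M]
    (hsmooth : ContMDiff ((𝓡 n).prod (𝓡 m)) (𝓡 m) 1 (fun p : G × M => p.1 • p.2))
    (hfree : ∀ x : M, DiscreteTopology (MulAction.stabilizer G x))
    (α : Module.Dual ℝ 𝔞) (hα : IsRoot 𝔞 α)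
    (s : G) (hs : s ∈ rootKernel 𝔞 α) (hs1 : s ≠ 1)
    (μ : Measure M) [IsProbabilityMeasure μ]
    (herg : Ergodic (fun x : M => s • x) μ)
    (hinv : SMulInvariantMeasure
      ↥(Subgroup.centralizer (torus 𝔞 : Set G) ⊔ (unstableSubgroup s ⊔ rootSubgroup 𝔞 α)) M μ)
    (ν : M → Measure (rootSubgroup 𝔞 (-α)))
    (hν : IsLeafwiseFamily (rootSubgroup 𝔞 (-α)) μ ν)
    (hna : ∀ᵐ x ∂μ, ∀ h, ν x {h} = 0) :
    SMulInvariantMeasure (rootSubgroup 𝔞 (-α)) M μ := by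
  have hβ : -α ≠ 0 := neg_ne_zero.2 hα.1
  rcases expSubgroup_eq_bot_or_exists (finrank_rootSpace_le_one hβ) with
    h | ⟨γ, X, hX, hX0, hγ0, hγ, hH⟩
  · refine ⟨fun ⟨g, hg⟩ A _ => ?_⟩
    have hg1 : g = 1 := by
      rw [rootSubgroup, h] at hg
      exact Subgroup.mem_bot.1 hg
    subst hg1
    congr 1
    ext x
    exact iff_of_eq (congrArg (· ∈ A) (one_smul G x))
  · obtain ⟨Y, Z, hZ, hYZ⟩ := exists_adjoint_eq_add_smul hβ hX hX0 hγ0 hγ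
    refine smulInvariantMeasure_of_oneParameter hsmooth.continuous herg hγ.continuous hγ0
      (integralCurve_add hγ hγ0) hH (commute_of_mem_rootKernel hs hX hγ0 hγ) ?_ ?_ hν hna
    -- Since `Ad (γ t) Y - Y = t • Z` with `Z ≠ 0`, closeness of `γ t` to `1` bounds `|t|`.
    · intro ε hε
      have hpos : 0 < ε * ‖Z‖ := mul_pos hε (norm_pos_iff.2 hZ)
      refine ⟨_, (continuousAt_adjoint Y).preimage_mem_nhds (Metric.ball_mem_nhds _ hpos),
        fun t ht => ?_⟩
      rw [Set.mem_preimage, mem_ball_iff_norm, hYZ, adjoint_one, ContinuousLinearMap.id_apply,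
        add_sub_cancel_left, norm_smul, Real.norm_eq_abs] at ht
      exact lt_of_mul_lt_mul_right ht (norm_nonneg Z)
    · intro x
      by_contra! hx
      have := hfree x
      -- If `γ` fixed `x`, it would be a continuous curve in a discrete stabilizer, hence constant,
      -- contrary to `Ad (γ 1) Y = Y + Z`.
      let δ : ℝ → MulAction.stabilizer G x := fun t => ⟨γ t, hx t⟩
      have hδ : Continuous δ := hγ.continuous.subtype_mk _
      have h1 : γ 1 = γ 0 :=
        congrArg Subtype.val (PreconnectedSpace.constant inferInstance hδ (x := 1) (y := 0))
      have h2 := hYZ 1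
      rw [h1, hγ0, adjoint_one, ContinuousLinearMap.id_apply, one_smul] at h2
      exact hZ (left_eq_add.1 h2)
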